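/- Let $\lambda>0$, let $d\mu_\lambda(x)=(1-x^2)^{\lambda-1/2}\,dx$ on $(-1,1)$, let $C_n^\lambda$ be the ultraspherical (Gegenbauer) polynomial of degree $n$ and order $\lambda$, and let $c_n^\lambda=d_n^{-1}C_n^\lambda$ with $d_n^2=\int_{-1}^1 (C_n^\lambda)^2\,d\mu_\lambda$. For real-valued $u\in L^2((-1,1),d\mu_\lambda)$ put $a_n(u)=\int_{-1}^1 u\,c_n^\lambda\,d\mu_\lambda$, and let $\psi=\Gamma'/\Gamma$ be the digamma function. Let $u\in L^2((-1,1),d\mu_\lambda)$ be such that the series $\sum_{n\ge 0}\psi(n+\lambda+\tfrac12)\,a_n(u)^2$ converges; this holds in particular whenever, for some $\sigma>0$, $u$ lies in the Sobolev space $H^\sigma_\lambda=\{f\in L^2((-1,1),d\mu_\lambda):\sum_{n\ge0}(n+\lambda)^\sigma a_n(f)^2<\infty\}$. Then $\log(\sqrt{1-x^2})\,u^2(x)$ is integrable with respect to $\mu_\lambda$, and $$\Bigl(\log 2+\psi\bigl(\tfrac{\lambda}{2}+\tfrac14\bigr)\Bigr)\int_{-1}^1u^2\,d\mu_\lambda\le\sum_{n=0}^\infty\psi\bigl(n+\lambda+\tfrac12\bigr)a_n(u)^2+\int_{-1}^1\log\bigl(\sqrt{1-x^2}\bigr)\,u^2(x)\,d\mu_\lambda(x).$$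 -/

import Mathlib

open MeasureTheory Polynomial

noncomputable section

/-- The ultraspherical (Gegenbauer) polynomial of degree `n` and order `lam`, through its
three-term recurrence
`(n + 2) C_{n+2} = 2 (n + 1 + lam) x C_{n+1} - (n + 2 lam) C_n`, `C_0 = 1`, `C_1 = 2 lam x`. -/
def ultraPoly (lam : ℝ) : ℕ → ℝ[X]
  | 0 => 1
  | 1 => C (2 * lam) * X
  | (n + 2) =>
      C (1 / ((n : ℝ) + 2)) *
        (C (2 * ((n : ℝ) + 1 + lam)) * X * ultraPoly lam (n + 1)
          - C ((n : ℝ) + 2 * lam) * ultraPoly lam n)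

/-- The measure `(1 - x ^ 2) ^ (lam - 1 / 2) dx` on the interval `(-1, 1)`. -/
def ultraMeasure (lam : ℝ) : Measure ℝ :=
  (volume.restrict (Set.Ioo (-1 : ℝ) 1)).withDensity
    (fun x => ENNReal.ofReal ((1 - x ^ 2) ^ (lam - 1 / 2)))

/-- The norm `d_n` of the `n`-th ultraspherical polynomial in `L²`. -/
def ultraNorm (lam : ℝ) (n : ℕ) : ℝ :=
  Real.sqrt (∫ x, ((ultraPoly lam n).eval x) ^ 2 ∂(ultraMeasure lam))

/-- The normalized ultraspherical polynomial `c_n = C_n / d_n`, as a function. -/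
def ultraBasis (lam : ℝ) (n : ℕ) (x : ℝ) : ℝ :=
  (ultraNorm lam n)⁻¹ * (ultraPoly lam n).eval x

/-- The `n`-th ultraspherical Fourier coefficient of `f`. -/
def ultraCoeff (lam : ℝ) (f : ℝ → ℝ) (n : ℕ) : ℝ :=
  ∫ y, f y * ultraBasis lam n y ∂(ultraMeasure lam)

/-- The digamma function `Γ' / Γ` on the real line. -/
def realDigamma (a : ℝ) : ℝ := deriv Real.Gamma a / Real.Gamma a

/-- Membership in the Sobolev space of order `σ`: the functions of `L²` with
`∑ (n + lam) ^ σ * a_n ^ 2 < ∞`. -/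
def MemUltraSobolev (lam σ : ℝ) (f : ℝ → ℝ) : Prop :=
  MemLp f 2 (ultraMeasure lam) ∧
    Summable (fun n : ℕ => ((n : ℝ) + lam) ^ σ * (ultraCoeff lam f n) ^ 2)

/-- Membership in the natural domain of the logarithmic inequality: the functions of `L²` for
which `∑ ψ (n + lam + 1 / 2) * a_n ^ 2` converges. -/
def MemUltraLog (lam : ℝ) (f : ℝ → ℝ) : Prop :=
  MemLp f 2 (ultraMeasure lam) ∧
    Summable (fun n : ℕ => realDigamma ((n : ℝ) + lam + 1 / 2) * (ultraCoeff lam f n) ^ 2)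

end

open scoped Topology

/-! The inequality is the derivative at `h = 0` of a sharp Pitt inequality: for `0 < h < lam + 1/2`,
the sum of `m_n(h) a_n(u) ^ 2` is at most `c(h) ∫ (1 - x ^ 2) ^ h u ^ 2 dμ`, where `m_n(h) = Γ(n +
lam + 1/2 - h) / Γ(n + lam + 1/2 + h)` and `c(0) = 1` (`pitt_inequality`).

Pitt's inequality is a Schur test for the operator `A` that multiplies `C_n` by `m_n(h)`. Two facts
are needed. First, `A` preserves positivity: it is a Beta-weighted average of Poisson operators
(`Gamma_mul_eval_pittMultiplier`), and these preserve positivity by a minimum principle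
(`poissonOp_nonneg`). Second, `A` formally sends `(1 - x ^ 2) ^ (-(lam/2 + 1/4 + h/2))` to `c(h) (1
- x ^ 2) ^ (-(lam/2 + 1/4 - h/2))`. This is stated in dual form, as an identity between integrals of
polynomials (`ultraIntegral_pittMultiplier`). No integral kernel is ever written down: the test is
run on polynomials (`schur_test_pittMultiplier`), with polynomial approximations from below of the
singular test function, and then extended to `L²` by density.

For the passage to `h = 0`, the bound `1 - 2 h ψ(n + lam + 1/2) ≤ m_n(h)` holds for every admissible
`h`, not just to first order (`one_sub_digamma_le_pittMultiplier`), so limit and sum need not be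
interchanged. With Parseval it gives an inequality linear in the digamma sum. Dividing by `2 h` and
letting `h → 0`, the derivative of `c` yields the constant, and Fatou's lemma yields both the
integrability and the bound for the logarithmic term (`log_inequality`). -/

/-! ### Recurrences and differential equation of the ultraspherical polynomials. -/

theorem ultraPoly_recurrence (lam : ℝ) (n : ℕ) :
    C ((n : ℝ) + 2) * ultraPoly lam (n + 2) =
      C (2 * ((n : ℝ) + 1 + lam)) * X * ultraPoly lam (n + 1)
        - C ((n : ℝ) + 2 * lam) * ultraPoly lam n := by
  have h : ((n : ℝ) + 2) ≠ 0 := by positivity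
  rw [ultraPoly, ← mul_assoc, ← C_mul, mul_one_div_cancel h, C_1, one_mul]

/-- The relations are proved jointly: the differentiated three-term recurrence and the first
relation give the second one at the next index, which in turn gives the first. -/
theorem derivative_ultraPoly_relations (lam : ℝ) (n : ℕ) :
    X * derivative (ultraPoly lam (n + 1)) - derivative (ultraPoly lam n)
        = C ((n : ℝ) + 1) * ultraPoly lam (n + 1) ∧
      derivative (ultraPoly lam (n + 1)) - X * derivative (ultraPoly lam n)
        = C ((n : ℝ) + 2 * lam) * ultraPoly lam n := by
  induction n with
  | zero => simp [ultraPoly, mul_comm]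
  | succ n ih =>
    obtain ⟨h1, h2⟩ := ih
    have hR := ultraPoly_recurrence lam n
    have hR' := congrArg derivative hR
    have hne : C ((n : ℝ) + 2) ≠ 0 := by
      rw [Ne, C_eq_zero]; positivity
    simp only [derivative_mul, derivative_sub, derivative_C, derivative_X, zero_mul, zero_add,
      mul_one] at hR'
    push_cast at *
    simp only [C_add, C_mul, C_1, C_ofNat] at *
    have h3 : derivative (ultraPoly lam (n + 2)) - X * derivative (ultraPoly lam (n + 1))
        = (C (n : ℝ) + 1 + 2 * C lam) * ultraPoly lam (n + 1) := by
      apply mul_left_cancel₀ hne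
      linear_combination hR' + (C (n : ℝ) + 2 * C lam) * h1
    refine ⟨?_, h3⟩
    linear_combination X * h3 - hR + X * h1 - h2

theorem derivative_ultraPoly_lower (lam : ℝ) (n : ℕ) :
    X * derivative (ultraPoly lam (n + 1)) - derivative (ultraPoly lam n)
        = C ((n : ℝ) + 1) * ultraPoly lam (n + 1) :=
  (derivative_ultraPoly_relations lam n).1

theorem derivative_ultraPoly_upper (lam : ℝ) (n : ℕ) :
    derivative (ultraPoly lam (n + 1)) - X * derivative (ultraPoly lam n)
        = C ((n : ℝ) + 2 * lam) * ultraPoly lam n :=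
  (derivative_ultraPoly_relations lam n).2

theorem ultraPoly_ode (lam : ℝ) (n : ℕ) :
    (1 - X ^ 2) * derivative (derivative (ultraPoly lam n))
        - C (2 * lam + 1) * X * derivative (ultraPoly lam n)
        + C ((n : ℝ) * (n + 2 * lam)) * ultraPoly lam n = 0 := by
  cases n with
  | zero => simp [ultraPoly]
  | succ n =>
    have h1 := derivative_ultraPoly_lower lam n
    have h2 := derivative_ultraPoly_upper lam n
    have h3 : (X ^ 2 - 1) * derivative (ultraPoly lam (n + 1))
        = C ((n : ℝ) + 1) * X * ultraPoly lam (n + 1)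
          - C ((n : ℝ) + 2 * lam) * ultraPoly lam n := by
      linear_combination X * h1 - h2
    have h4 := congrArg derivative h3
    simp only [derivative_mul, derivative_sub, derivative_C, derivative_X, derivative_X_pow,
      derivative_one, zero_mul, zero_add, mul_one] at h4
    push_cast at *
    simp only [C_add, C_mul, C_1, C_ofNat] at *
    linear_combination -h4 - (C (n : ℝ) + 2 * C lam) * h1

/-! ### The ultraspherical basis of the polynomials and diagonal operators. -/

theorem natDegree_ultraPoly_le (lam : ℝ) (n : ℕ) :
    (ultraPoly lam n).natDegree ≤ n ∧ (ultraPoly lam (n + 1)).natDegree ≤ n + 1 := by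
  induction n with
  | zero =>
    simp only [ultraPoly, natDegree_one, le_refl, true_and]
    compute_degree
  | succ n ih =>
    refine ⟨ih.2, ?_⟩
    obtain ⟨h1, h2⟩ := ih
    rw [ultraPoly]
    refine (natDegree_C_mul_le _ _).trans ((natDegree_sub_le _ _).trans (max_le ?_ ?_))
    · refine (natDegree_mul_le).trans ?_
      have : (C (2 * ((n : ℝ) + 1 + lam)) * X).natDegree ≤ 1 := by compute_degree
      omega
    · exact (natDegree_C_mul_le _ _).trans (by omega)

theorem coeff_ultraPoly_pos {lam : ℝ} (hlam : 0 < lam) (n : ℕ) :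
    0 < (ultraPoly lam n).coeff n ∧ 0 < (ultraPoly lam (n + 1)).coeff (n + 1) := by
  induction n with
  | zero => simp [ultraPoly, hlam]
  | succ n ih =>
    refine ⟨ih.2, ?_⟩
    have h0 : (ultraPoly lam n).coeff (n + 2) = 0 :=
      coeff_eq_zero_of_natDegree_lt (by have := (natDegree_ultraPoly_le lam n).1; omega)
    rw [ultraPoly, coeff_C_mul, coeff_sub, coeff_C_mul, h0, mul_assoc, coeff_C_mul, coeff_X_mul]
    have := ih.2
    simp only [mul_zero, sub_zero]
    positivity

theorem degree_ultraPoly {lam : ℝ} (hlam : 0 < lam) (n : ℕ) : (ultraPoly lam n).degree = n :=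
  degree_eq_of_le_of_coeff_ne_zero
    (natDegree_le_iff_degree_le.mp (natDegree_ultraPoly_le lam n).1)
    (coeff_ultraPoly_pos hlam n).1.ne'

theorem ultraPoly_ne_zero {lam : ℝ} (hlam : 0 < lam) (n : ℕ) : ultraPoly lam n ≠ 0 := by
  intro h
  have := degree_ultraPoly hlam n
  simp [h] at this

/-- The ultraspherical polynomials as a basis of the space of polynomials. -/
noncomputable def ultraPolyBasis {lam : ℝ} (hlam : 0 < lam) : Module.Basis ℕ ℝ ℝ[X] :=
  Polynomial.Sequence.basis ⟨ultraPoly lam, degree_ultraPoly hlam⟩ (fun i =>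
    (leadingCoeff_ne_zero.mpr (ultraPoly_ne_zero hlam i)).isUnit)

@[simp]
theorem ultraPolyBasis_apply {lam : ℝ} (hlam : 0 < lam) (n : ℕ) :
    ultraPolyBasis hlam n = ultraPoly lam n := by
  rw [ultraPolyBasis, Polynomial.Sequence.basis_eq_self]

/-- The linear operator on polynomials that multiplies the `n`-th ultraspherical polynomial
by `m n`. -/
noncomputable def ultraMultiplier {lam : ℝ} (hlam : 0 < lam) (m : ℕ → ℝ) : ℝ[X] →ₗ[ℝ] ℝ[X] :=
  (ultraPolyBasis hlam).constr ℝ (fun n => m n • ultraPoly lam n)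

@[simp]
theorem ultraMultiplier_ultraPoly {lam : ℝ} (hlam : 0 < lam) (m : ℕ → ℝ) (n : ℕ) :
    ultraMultiplier hlam m (ultraPoly lam n) = m n • ultraPoly lam n := by
  rw [ultraMultiplier, ← ultraPolyBasis_apply hlam, Module.Basis.constr_basis,
    ultraPolyBasis_apply]

theorem ultraPoly_induction {lam : ℝ} (hlam : 0 < lam) {P : ℝ[X] → Prop} (f : ℝ[X])
    (hbase : ∀ n, P (ultraPoly lam n)) (hzero : P 0)
    (hadd : ∀ f g, P f → P g → P (f + g)) (hsmul : ∀ (c : ℝ) f, P f → P (c • f)) : P f := by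
  have hf : f ∈ Submodule.span ℝ (Set.range (ultraPolyBasis hlam)) := by
    rw [Module.Basis.span_eq]; trivial
  induction hf using Submodule.span_induction with
  | mem x hx => obtain ⟨n, rfl⟩ := hx; simpa using hbase n
  | zero => exact hzero
  | add x y _ _ hx hy => exact hadd x y hx hy
  | smul a x _ hx => exact hsmul a x hx

/-! ### Beta integrals and the weighted measures. -/

theorem intervalIntegral_beta {a b : ℝ} (ha : 0 < a) (hb : 0 < b) :
    IntervalIntegrable (fun x : ℝ => x ^ (a - 1) * (1 - x) ^ (b - 1)) volume 0 1 ∧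
      ∫ x in (0 : ℝ)..1, x ^ (a - 1) * (1 - x) ^ (b - 1)
        = Real.Gamma a * Real.Gamma b / Real.Gamma (a + b) := by
  have hconv := Complex.betaIntegral_convergent (u := (a : ℂ)) (v := (b : ℂ)) (by simpa) (by simpa)
  have key : ∀ x ∈ Set.Ioc (0 : ℝ) 1,
      ((x : ℂ) ^ ((a : ℂ) - 1) * (1 - (x : ℂ)) ^ ((b : ℂ) - 1))
        = ((x ^ (a - 1) * (1 - x) ^ (b - 1) : ℝ) : ℂ) := by
    intro x hx
    rw [Complex.ofReal_mul, Complex.ofReal_cpow hx.1.le, Complex.ofReal_cpow (by linarith [hx.2])]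
    push_cast
    rfl
  rw [intervalIntegrable_iff_integrableOn_Ioc_of_le zero_le_one] at hconv ⊢
  have h1 := (integrableOn_congr_fun key measurableSet_Ioc).mp hconv
  refine ⟨by simpa [IntegrableOn] using h1.re, ?_⟩
  have h2 := Complex.betaIntegral_eq_Gamma_mul_div (a : ℂ) (b : ℂ) (by simpa) (by simpa)
  rw [Complex.betaIntegral, intervalIntegral.integral_of_le zero_le_one,
    setIntegral_congr_fun measurableSet_Ioc key, integral_complex_ofReal,
    ← Complex.ofReal_add, Complex.Gamma_ofReal, Complex.Gamma_ofReal, Complex.Gamma_ofReal] at h2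
  rw [intervalIntegral.integral_of_le zero_le_one]
  exact_mod_cast h2

theorem intervalIntegral_ultraWeight {s : ℝ} (hs : -1 / 2 < s) :
    IntervalIntegrable (fun x : ℝ => (1 - x ^ 2) ^ (s - 1 / 2)) volume (-1) 1 ∧
      ∫ x in (-1 : ℝ)..1, (1 - x ^ 2) ^ (s - 1 / 2)
        = 2 ^ (2 * s) * (Real.Gamma (s + 1 / 2) ^ 2 / Real.Gamma (2 * s + 1)) := by
  have hs' : 0 < s + 1 / 2 := by linarith
  obtain ⟨h1, h2⟩ := intervalIntegral_beta hs' hs'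
  have key : ∀ x : ℝ, x ∈ Set.Ioo (-1 : ℝ) 1 → (1 - x ^ 2) ^ (s - 1 / 2) =
      2 ^ (2 * s - 1) * ((2⁻¹ * x + 2⁻¹) ^ (s + 1 / 2 - 1) *
        (1 - (2⁻¹ * x + 2⁻¹)) ^ (s + 1 / 2 - 1)) := by
    intro x hx
    have e1 : (2 : ℝ) ^ (2 * s - 1) = 4 ^ (s + 1 / 2 - 1) := by
      rw [show (4 : ℝ) = 2 ^ (2 : ℝ) by norm_num, ← Real.rpow_mul (by norm_num)]
      congr 1; ring
    have p1 : 0 ≤ 2⁻¹ * x + 2⁻¹ := by linarith [hx.1]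
    have p2 : 0 ≤ 1 - (2⁻¹ * x + 2⁻¹) := by linarith [hx.2]
    rw [e1, ← Real.mul_rpow p1 p2, ← Real.mul_rpow (by norm_num) (mul_nonneg p1 p2)]
    congr 1 <;> ring
  constructor
  · have h3 := ((h1.comp_add_right (2⁻¹ : ℝ)).comp_mul_left (c := (2⁻¹ : ℝ))).const_mul (2 ^ (2 * s - 1))
    norm_num at h3
    rw [intervalIntegrable_iff_integrableOn_Ioo_of_le (by norm_num)] at h3 ⊢
    refine (integrableOn_congr_fun (fun x hx => ?_) measurableSet_Ioo).mpr h3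
    have := key x hx
    norm_num at this
    norm_num [this]
  · rw [intervalIntegral.integral_of_le (by norm_num), integral_Ioc_eq_integral_Ioo,
      setIntegral_congr_fun measurableSet_Ioo key, ← integral_Ioc_eq_integral_Ioo,
      ← intervalIntegral.integral_of_le (by norm_num), intervalIntegral.integral_const_mul,
      intervalIntegral.integral_comp_mul_add
        (fun x => x ^ (s + 1 / 2 - 1) * (1 - x) ^ (s + 1 / 2 - 1)) (by norm_num)]
    norm_num at h2 ⊢
    rw [h2, Real.rpow_sub (by norm_num), Real.rpow_one, show s + 1 / 2 + (s + 1 / 2) = 2 * s + 1 by ring]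
    ring

theorem integrableOn_ultraWeight {s : ℝ} (hs : -1 / 2 < s) :
    IntegrableOn (fun x : ℝ => (1 - x ^ 2) ^ (s - 1 / 2)) (Set.Ioo (-1) 1) := by
  rw [← intervalIntegrable_iff_integrableOn_Ioo_of_le (by norm_num)]
  exact (intervalIntegral_ultraWeight hs).1

theorem measurable_ultraWeight (t : ℝ) : Measurable (fun x : ℝ => (1 - x ^ 2) ^ t) := by
  fun_prop

theorem isFiniteMeasure_ultraMeasure {s : ℝ} (hs : -1 / 2 < s) :
    IsFiniteMeasure (ultraMeasure s) :=
  isFiniteMeasure_withDensity_ofReal (integrableOn_ultraWeight hs).2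

theorem ae_ultraMeasure_mem (s : ℝ) : ∀ᵐ x ∂(ultraMeasure s), x ∈ Set.Ioo (-1 : ℝ) 1 :=
  (withDensity_absolutelyContinuous _ _).ae_le (ae_restrict_mem measurableSet_Ioo)

theorem weight_pos {x : ℝ} (hx : x ∈ Set.Ioo (-1 : ℝ) 1) : 0 < 1 - x ^ 2 := by
  nlinarith [hx.1, hx.2]

theorem weight_nonneg {x : ℝ} (hx : x ∈ Set.Icc (-1 : ℝ) 1) : 0 ≤ 1 - x ^ 2 := by
  nlinarith [hx.1, hx.2]

theorem integral_ultraMeasure (s : ℝ) (f : ℝ → ℝ) :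
    ∫ x, f x ∂(ultraMeasure s) = ∫ x in Set.Ioo (-1 : ℝ) 1, (1 - x ^ 2) ^ (s - 1 / 2) * f x := by
  rw [ultraMeasure, integral_withDensity_eq_integral_toReal_smul
    (measurable_ultraWeight _).ennreal_ofReal (by simp)]
  refine setIntegral_congr_fun measurableSet_Ioo fun x hx => ?_
  simp only [smul_eq_mul]
  rw [ENNReal.toReal_ofReal (Real.rpow_nonneg (weight_pos hx).le _)]

theorem integral_ultraMeasure_eq_of_rpow (s t : ℝ) (f : ℝ → ℝ) :
    ∫ x, (1 - x ^ 2) ^ (s - t) * f x ∂(ultraMeasure t) = ∫ x, f x ∂(ultraMeasure s) := by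
  rw [integral_ultraMeasure, integral_ultraMeasure]
  refine setIntegral_congr_fun measurableSet_Ioo fun x hx => ?_
  rw [← mul_assoc, ← Real.rpow_add (weight_pos hx)]
  congr 2; ring

theorem integrable_ultraMeasure_iff (s : ℝ) (f : ℝ → ℝ) :
    Integrable f (ultraMeasure s) ↔
      IntegrableOn (fun x => (1 - x ^ 2) ^ (s - 1 / 2) * f x) (Set.Ioo (-1 : ℝ) 1) := by
  rw [ultraMeasure, integrable_withDensity_iff_integrable_smul'
    (measurable_ultraWeight _).ennreal_ofReal (by simp)]
  refine integrableOn_congr_fun (fun x hx => ?_) measurableSet_Ioo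
  simp only [smul_eq_mul]
  rw [ENNReal.toReal_ofReal (Real.rpow_nonneg (weight_pos hx).le _)]

theorem integrable_ultraMeasure_rpow_iff (s t : ℝ) (f : ℝ → ℝ) :
    Integrable (fun x => (1 - x ^ 2) ^ (s - t) * f x) (ultraMeasure t) ↔
      Integrable f (ultraMeasure s) := by
  rw [integrable_ultraMeasure_iff, integrable_ultraMeasure_iff]
  refine integrableOn_congr_fun (fun x hx => ?_) measurableSet_Ioo
  rw [← mul_assoc, ← Real.rpow_add (weight_pos hx)]
  congr 2; ring

theorem integrable_ultraMeasure_of_continuousOn {s : ℝ} (hs : -1 / 2 < s) {f : ℝ → ℝ}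
    (hf : ContinuousOn f (Set.Icc (-1) 1)) : Integrable f (ultraMeasure s) := by
  rw [integrable_ultraMeasure_iff]
  have h := (intervalIntegral_ultraWeight hs).1.mul_continuousOn
    (g := f) (by rwa [Set.uIcc_of_le (by norm_num)])
  rwa [intervalIntegrable_iff_integrableOn_Ioo_of_le (by norm_num)] at h

theorem integrable_ultraMeasure_polynomial {s : ℝ} (hs : -1 / 2 < s) (f : ℝ[X]) :
    Integrable (fun x => f.eval x) (ultraMeasure s) :=
  integrable_ultraMeasure_of_continuousOn hs f.continuous.continuousOn

theorem integral_ultraMeasure_one {s : ℝ} (hs : -1 / 2 < s) :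
    ∫ _, (1 : ℝ) ∂(ultraMeasure s)
      = 2 ^ (2 * s) * (Real.Gamma (s + 1 / 2) ^ 2 / Real.Gamma (2 * s + 1)) := by
  rw [integral_ultraMeasure, ← (intervalIntegral_ultraWeight hs).2,
    intervalIntegral.integral_of_le (by norm_num), integral_Ioc_eq_integral_Ioo]
  simp

/-! ### Integration by parts, orthogonality and moments. -/

/-- The weighted integrand is the derivative of `(1 - x ^ 2) ^ (s + 1/2) q`, which vanishes at both
endpoints. -/
theorem integral_ultraMeasure_divergence {s : ℝ} (hs : -1 / 2 < s) (q : ℝ[X]) :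
    ∫ x, ((1 - X ^ 2) * derivative q - C (2 * s + 1) * X * q).eval x ∂(ultraMeasure s) = 0 := by
  have hs' : 0 < s + 1 / 2 := by linarith
  have hint := integrable_ultraMeasure_polynomial hs
    ((1 - X ^ 2) * derivative q - C (2 * s + 1) * X * q)
  rw [integrable_ultraMeasure_iff] at hint
  rw [integral_ultraMeasure, ← integral_Ioc_eq_integral_Ioo,
    ← intervalIntegral.integral_of_le (by norm_num),
    intervalIntegral.integral_eq_sub_of_hasDerivAt_of_le (by norm_num)
      (f := fun x => (1 - x ^ 2) ^ (s + 1 / 2) * q.eval x)]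
  · norm_num [Real.zero_rpow hs'.ne']
  · exact ((by fun_prop : Continuous fun x : ℝ => 1 - x ^ 2).rpow_const
      (fun x => Or.inr hs'.le)).continuousOn.mul q.continuous.continuousOn
  · intro x hx
    have h1 : HasDerivAt (fun x : ℝ => 1 - x ^ 2) (-(2 * x)) x := by
      simpa using (hasDerivAt_pow 2 x).const_sub 1
    have h2 := (h1.rpow_const (p := s + 1 / 2) (Or.inl (weight_pos hx).ne')).mul (q.hasDerivAt x)
    refine h2.congr_deriv ?_
    simp only [eval_sub, eval_mul, eval_C, eval_X, eval_pow, eval_one]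
    rw [show s + 1 / 2 = (s - 1 / 2) + 1 by ring, Real.rpow_add_one (weight_pos hx).ne']
    ring_nf
  · rwa [intervalIntegrable_iff_integrableOn_Ioo_of_le (by norm_num)]

/-- Integration of polynomials against `ultraMeasure s`, as a linear form. -/
noncomputable def ultraIntegral {s : ℝ} (hs : -1 / 2 < s) : ℝ[X] →ₗ[ℝ] ℝ where
  toFun f := ∫ x, f.eval x ∂(ultraMeasure s)
  map_add' f g := by
    simp only [eval_add]
    exact integral_add (integrable_ultraMeasure_polynomial hs f)
      (integrable_ultraMeasure_polynomial hs g)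
  map_smul' c f := by
    simp only [eval_smul, smul_eq_mul, RingHom.id_apply]
    exact integral_const_mul _ _

theorem ultraIntegral_apply {s : ℝ} (hs : -1 / 2 < s) (f : ℝ[X]) :
    ultraIntegral hs f = ∫ x, f.eval x ∂(ultraMeasure s) := rfl

theorem ultraIntegral_C_mul {s : ℝ} (hs : -1 / 2 < s) (c : ℝ) (f : ℝ[X]) :
    ultraIntegral hs (C c * f) = c * ultraIntegral hs f := by
  rw [← smul_eq_C_mul, map_smul, smul_eq_mul]

theorem ultraIntegral_divergence {s : ℝ} (hs : -1 / 2 < s) (q : ℝ[X]) :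
    ultraIntegral hs ((1 - X ^ 2) * derivative q - C (2 * s + 1) * X * q) = 0 :=
  integral_ultraMeasure_divergence hs q

theorem ultraIntegral_nonneg {s : ℝ} (hs : -1 / 2 < s) {f : ℝ[X]}
    (hf : ∀ x ∈ Set.Icc (-1 : ℝ) 1, 0 ≤ f.eval x) : 0 ≤ ultraIntegral hs f := by
  refine integral_nonneg_of_ae ?_
  filter_upwards [ae_ultraMeasure_mem s] with x hx using hf x (Set.Ioo_subset_Icc_self hx)

theorem neg_half_lt_of_pos {lam : ℝ} (hlam : 0 < lam) : -1 / 2 < lam := by linarith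

theorem ultraIntegral_sq_pos {s : ℝ} (hs : -1 / 2 < s) {f : ℝ[X]} (hf : f ≠ 0) :
    0 < ultraIntegral hs (f ^ 2) := by
  have hint := integrable_ultraMeasure_polynomial hs (f ^ 2)
  rw [integrable_ultraMeasure_iff] at hint
  rw [ultraIntegral_apply, integral_ultraMeasure, setIntegral_pos_iff_support_of_nonneg_ae _ hint]
  · have hsub : Set.Ioo (-1 : ℝ) 1 \ {x | f.IsRoot x} ⊆
        (Function.support fun x => (1 - x ^ 2) ^ (s - 1 / 2) * (f ^ 2).eval x)
          ∩ Set.Ioo (-1 : ℝ) 1 := by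
      intro x hx
      have h1 := Real.rpow_pos_of_pos (weight_pos hx.1) (s - 1 / 2)
      have h2 : f.eval x ≠ 0 := hx.2
      refine ⟨?_, hx.1⟩
      simp only [Function.mem_support, eval_pow]
      positivity
    refine lt_of_lt_of_le ?_ (measure_mono hsub)
    rw [measure_sdiff_null ((Polynomial.finite_setOfPred_isRoot hf).measure_zero _)]
    simp
  · filter_upwards [ae_restrict_mem measurableSet_Ioo] with x hx
    have := Real.rpow_pos_of_pos (weight_pos hx) (s - 1 / 2)
    simp only [eval_pow, Pi.zero_apply]
    positivity

theorem ultraIntegral_ultraPoly_mul_of_ne {lam : ℝ} (hlam : 0 < lam) {i j : ℕ} (hij : i ≠ j) :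
    ultraIntegral (neg_half_lt_of_pos hlam) (ultraPoly lam i * ultraPoly lam j) = 0 := by
  -- The field is the Wronskian of the two polynomials; its weighted divergence is the eigenvalue
  -- gap times their product.
  have h := ultraIntegral_divergence (neg_half_lt_of_pos hlam)
    (derivative (ultraPoly lam i) * ultraPoly lam j
      - ultraPoly lam i * derivative (ultraPoly lam j))
  have hi := ultraPoly_ode lam i
  have hj := ultraPoly_ode lam j
  have key : (1 - X ^ 2) * derivative (derivative (ultraPoly lam i) * ultraPoly lam j
        - ultraPoly lam i * derivative (ultraPoly lam j)) - C (2 * lam + 1) * X *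
        (derivative (ultraPoly lam i) * ultraPoly lam j
          - ultraPoly lam i * derivative (ultraPoly lam j))
      = C ((j : ℝ) * (j + 2 * lam) - i * (i + 2 * lam)) * (ultraPoly lam i * ultraPoly lam j) := by
    rw [C_sub, derivative_sub, derivative_mul, derivative_mul]
    linear_combination ultraPoly lam j * hi - ultraPoly lam i * hj
  rw [key, ultraIntegral_C_mul] at h
  refine (mul_eq_zero.mp h).resolve_left ?_
  have h1 : ((j : ℝ) - i) ≠ 0 := sub_ne_zero.mpr (by exact_mod_cast hij.symm)
  have h2 : (j : ℝ) + i + 2 * lam ≠ 0 := by positivity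
  rw [show (j : ℝ) * (j + 2 * lam) - i * (i + 2 * lam) = (j - i) * (j + i + 2 * lam) by ring]
  exact mul_ne_zero h1 h2

theorem ultraIntegral_ultraPoly_one {lam : ℝ} {s : ℝ} (hs : -1 / 2 < s) :
    ultraIntegral hs (ultraPoly lam 1) = 0 := by
  have h := ultraIntegral_divergence hs 1
  rw [derivative_one, mul_zero, zero_sub, mul_one, map_neg, ultraIntegral_C_mul, neg_eq_zero] at h
  have h2 := (mul_eq_zero.mp h).resolve_left (by linarith)
  rw [ultraPoly, ultraIntegral_C_mul, h2, mul_zero]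

/-- The order `s` of the weight differs from the order `lam` of the polynomial. Integrating the
differential equation against the wrong weight leaves a multiple of `∫ x C_k'` (`euler`), and the
two derivative relations tie this quantity at `n + 2` to that at `n`. -/
theorem ultraIntegral_ultraPoly_add_two (lam : ℝ) {s : ℝ} (hs : -1 / 2 < s) (n : ℕ) :
    ((n : ℝ) + 2) * (n + 2 + 2 * s) * ultraIntegral hs (ultraPoly lam (n + 2))
      = (n + 2 * lam) * (n + 2 * lam - 2 * s) * ultraIntegral hs (ultraPoly lam n) := by
  have euler : ∀ k : ℕ, (2 * lam - 2 * s) * ultraIntegral hs (X * derivative (ultraPoly lam k))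
      = k * (k + 2 * lam) * ultraIntegral hs (ultraPoly lam k) := by
    intro k
    have h1 := ultraIntegral_divergence hs (derivative (ultraPoly lam k))
    have h2 : (1 - X ^ 2) * derivative (derivative (ultraPoly lam k))
        - C (2 * s + 1) * X * derivative (ultraPoly lam k)
        = C (2 * lam - 2 * s) * (X * derivative (ultraPoly lam k))
          - C ((k : ℝ) * (k + 2 * lam)) * ultraPoly lam k := by
      have h3 := ultraPoly_ode lam k
      simp only [C_add, C_sub, C_1] at *
      linear_combination h3
    rw [h2, map_sub, ultraIntegral_C_mul, ultraIntegral_C_mul] at h1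
    linear_combination h1
  have h1 := congrArg (ultraIntegral hs) (derivative_ultraPoly_upper lam n)
  have h2 := congrArg (ultraIntegral hs) (derivative_ultraPoly_lower lam (n + 1))
  rw [map_sub, ultraIntegral_C_mul] at h1 h2
  have e1 := euler n
  have e2 := euler (n + 2)
  push_cast at *
  linear_combination (2 * lam - 2 * s) * (h1 + h2) + e1 - e2

theorem ultraIntegral_multiplier_mul {lam : ℝ} (hlam : 0 < lam) (m : ℕ → ℝ) (f g : ℝ[X]) :
    ultraIntegral (neg_half_lt_of_pos hlam) (ultraMultiplier hlam m f * g)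
      = ultraIntegral (neg_half_lt_of_pos hlam) (f * ultraMultiplier hlam m g) := by
  induction f using ultraPoly_induction hlam with
  | hzero => simp
  | hadd f₁ f₂ h1 h2 => rw [map_add, add_mul, add_mul, map_add, map_add, h1, h2]
  | hsmul c f h => rw [map_smul, smul_mul_assoc, smul_mul_assoc, map_smul, map_smul, h]
  | hbase i =>
    induction g using ultraPoly_induction hlam with
    | hzero => simp
    | hadd f₁ f₂ h1 h2 => rw [map_add, mul_add, mul_add, map_add, map_add, h1, h2]
    | hsmul c f h => rw [map_smul, mul_smul_comm, mul_smul_comm, map_smul, map_smul, h]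
    | hbase j =>
      rw [ultraMultiplier_ultraPoly, ultraMultiplier_ultraPoly, smul_mul_assoc, mul_smul_comm,
        map_smul, map_smul]
      by_cases hij : i = j
      · rw [hij]
      · rw [ultraIntegral_ultraPoly_mul_of_ne hlam hij, smul_zero, smul_zero]

/-! ### The Pitt multiplier and its action on power weights. -/

/-- The multiplier `Γ(n + lam + 1/2 - h) / Γ(n + lam + 1/2 + h)`. -/
noncomputable def pittMultiplier (lam h : ℝ) (n : ℕ) : ℝ :=
  Real.Gamma (n + lam + 1 / 2 - h) / Real.Gamma (n + lam + 1 / 2 + h)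

/-- The sharp constant in Pitt's inequality. -/
noncomputable def pittConst (lam h : ℝ) : ℝ :=
  2 ^ (-2 * h) * (Real.Gamma (lam / 2 + 1 / 4 - h / 2) ^ 2 /
    Real.Gamma (lam / 2 + 1 / 4 + h / 2) ^ 2)

theorem pittMultiplier_pos {lam h : ℝ} (h0 : 0 < h) (h1 : h < lam + 1 / 2) (n : ℕ) :
    0 < pittMultiplier lam h n := by
  have hn : (0 : ℝ) ≤ n := n.cast_nonneg
  exact div_pos (Real.Gamma_pos_of_pos (by linarith)) (Real.Gamma_pos_of_pos (by linarith))

theorem pittConst_pos {lam h : ℝ} (h0 : 0 < h) (h1 : h < lam + 1 / 2) : 0 < pittConst lam h := by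
  have e1 := Real.Gamma_pos_of_pos (s := lam / 2 + 1 / 4 - h / 2) (by linarith)
  have e2 := Real.Gamma_pos_of_pos (s := lam / 2 + 1 / 4 + h / 2) (by linarith)
  unfold pittConst
  positivity

theorem pittMultiplier_add_two {lam h : ℝ} (h0 : 0 < h) (h1 : h < lam + 1 / 2) (n : ℕ) :
    pittMultiplier lam h (n + 2) * ((n + lam + 1 / 2 + h) * (n + lam + 1 / 2 + h + 1))
      = pittMultiplier lam h n * ((n + lam + 1 / 2 - h) * (n + lam + 1 / 2 - h + 1)) := by
  have hn : (0 : ℝ) ≤ n := n.cast_nonneg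
  have step : ∀ z : ℝ, 0 < z → Real.Gamma (z + 2) = (z + 1) * (z * Real.Gamma z) := by
    intro z hz
    rw [show z + 2 = (z + 1) + 1 by ring, Real.Gamma_add_one (by positivity),
      Real.Gamma_add_one hz.ne']
  have p1 : 0 < (n : ℝ) + lam + 1 / 2 - h := by linarith
  have p2 : 0 < (n : ℝ) + lam + 1 / 2 + h := by linarith
  have g2 := (Real.Gamma_pos_of_pos p2).ne'
  unfold pittMultiplier
  push_cast
  rw [show (n : ℝ) + 2 + lam + 1 / 2 - h = (n + lam + 1 / 2 - h) + 2 by ring,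
    show (n : ℝ) + 2 + lam + 1 / 2 + h = (n + lam + 1 / 2 + h) + 2 by ring, step _ p1, step _ p2]
  have p3 : (n : ℝ) + lam + 1 / 2 + h + 1 ≠ 0 := by positivity
  have p4 := p2.ne'
  generalize (n : ℝ) + lam + 1 / 2 + h = a at *
  field_simp

/-- Both sides satisfy the same recursion from `n` to `n + 2`. The case `n = 0` fixes the constant
through the Beta integrals; for `n = 1` both integrals vanish by oddness. -/
theorem pittMultiplier_mul_ultraIntegral {lam h : ℝ} (hlam : 0 < lam) (h0 : 0 < h)
    (h1 : h < lam + 1 / 2) (hp : -1 / 2 < lam / 2 - 1 / 4 - h / 2)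
    (hm : -1 / 2 < lam / 2 - 1 / 4 + h / 2) (n : ℕ) :
    pittMultiplier lam h n * ultraIntegral hp (ultraPoly lam n)
        = pittConst lam h * ultraIntegral hm (ultraPoly lam n) := by
  induction n using Nat.twoStepInduction with
  | zero =>
    have q1 := (Real.Gamma_pos_of_pos (s := lam / 2 + 1 / 4 - h / 2) (by linarith)).ne'
    have q2 := (Real.Gamma_pos_of_pos (s := lam / 2 + 1 / 4 + h / 2) (by linarith)).ne'
    have q3 := (Real.Gamma_pos_of_pos (s := lam + 1 / 2 - h) (by linarith)).ne'
    have q4 := (Real.Gamma_pos_of_pos (s := lam + 1 / 2 + h) (by linarith)).ne'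
    simp only [ultraIntegral_apply, ultraPoly, eval_one]
    rw [integral_ultraMeasure_one hp, integral_ultraMeasure_one hm, pittMultiplier, pittConst,
      show lam / 2 - 1 / 4 - h / 2 + 1 / 2 = lam / 2 + 1 / 4 - h / 2 by ring,
      show lam / 2 - 1 / 4 + h / 2 + 1 / 2 = lam / 2 + 1 / 4 + h / 2 by ring,
      show 2 * (lam / 2 - 1 / 4 - h / 2) + 1 = lam + 1 / 2 - h by ring,
      show 2 * (lam / 2 - 1 / 4 + h / 2) + 1 = lam + 1 / 2 + h by ring,
      show 2 * (lam / 2 - 1 / 4 - h / 2) = -2 * h + 2 * (lam / 2 - 1 / 4 + h / 2) by ring,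
      Real.rpow_add (by norm_num)]
    simp only [Nat.cast_zero, zero_add]
    generalize Real.Gamma (lam / 2 + 1 / 4 - h / 2) = A at *
    generalize Real.Gamma (lam / 2 + 1 / 4 + h / 2) = B at *
    generalize Real.Gamma (lam + 1 / 2 - h) = D at *
    field_simp
  | one => rw [ultraIntegral_ultraPoly_one, ultraIntegral_ultraPoly_one, mul_zero, mul_zero]
  | more n ih _ =>
    have hn : (0 : ℝ) ≤ n := n.cast_nonneg
    have rp := ultraIntegral_ultraPoly_add_two lam hp n
    have rm := ultraIntegral_ultraPoly_add_two lam hm n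
    have rg := pittMultiplier_add_two h0 h1 n
    have ne1 : ((n : ℝ) + 2) * (n + lam + 1 / 2 + h + 1) * (n + lam + 1 / 2 - h + 1)
        * (n + lam + 1 / 2 + h) ≠ 0 := by
      have p1 : 0 < (n : ℝ) + lam + 1 / 2 - h + 1 := by linarith
      positivity
    apply mul_left_cancel₀ ne1
    generalize ultraIntegral hp (ultraPoly lam (n + 2)) = ip2 at *
    generalize ultraIntegral hm (ultraPoly lam (n + 2)) = im2 at *
    generalize ultraIntegral hp (ultraPoly lam n) = ip at *
    generalize ultraIntegral hm (ultraPoly lam n) = im at *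
    generalize pittMultiplier lam h (n + 2) = g2 at *
    generalize pittMultiplier lam h n = g at *
    generalize pittConst lam h = c at *
    linear_combination (((n : ℝ) + 2) * (n + lam + 1 / 2 - h + 1) * ip2) * rg
      + g * ((n : ℝ) + lam + 1 / 2 - h) * (n + lam + 1 / 2 - h + 1) * rp
      - c * (n + lam + 1 / 2 - h + 1) * (n + lam + 1 / 2 + h) * rm
      + ((n : ℝ) + lam + 1 / 2 - h) * (n + lam + 1 / 2 - h + 1) * (n + 2 * lam)
        * (n + lam + 1 / 2 + h) * ih

theorem ultraIntegral_pittMultiplier {lam h : ℝ} (hlam : 0 < lam) (h0 : 0 < h)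
    (h1 : h < lam + 1 / 2) (hp : -1 / 2 < lam / 2 - 1 / 4 - h / 2)
    (hm : -1 / 2 < lam / 2 - 1 / 4 + h / 2) (f : ℝ[X]) :
    ultraIntegral hp (ultraMultiplier hlam (pittMultiplier lam h) f)
        = pittConst lam h * ultraIntegral hm f := by
  induction f using ultraPoly_induction hlam with
  | hzero => simp
  | hadd f₁ f₂ h1 h2 => rw [map_add, map_add, map_add, h1, h2, mul_add]
  | hsmul c f h => rw [map_smul, map_smul, map_smul, h, mul_smul_comm]
  | hbase n =>
    rw [ultraMultiplier_ultraPoly, map_smul, smul_eq_mul,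
      pittMultiplier_mul_ultraIntegral hlam h0 h1 hp hm]

/-! ### First and second order conditions at minima of polynomials. -/

theorem Polynomial.exists_eq_add_X_sub_C_mul (p : ℝ[X]) (x : ℝ) :
    ∃ q : ℝ[X], p = C (p.eval x) + (X - C x) * q ∧ (derivative p).eval x = q.eval x := by
  obtain ⟨q, hq⟩ := dvd_iff_isRoot.mpr (show (p - C (p.eval x)).IsRoot x by simp)
  have h : p = C (p.eval x) + (X - C x) * q := by rw [← hq]; ring
  refine ⟨q, h, ?_⟩
  conv_lhs => rw [h]
  simp

theorem Polynomial.eval_nonneg_of_right {q : ℝ[X]} {x b : ℝ} (hxb : x < b)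
    (h : ∀ y ∈ Set.Ioo x b, 0 ≤ q.eval y) : 0 ≤ q.eval x := by
  have hq : Filter.Tendsto (fun y => q.eval y) (𝓝[>] x) (𝓝 (q.eval x)) :=
    (q.continuous.tendsto x).mono_left nhdsWithin_le_nhds
  refine ge_of_tendsto hq ?_
  filter_upwards [Ioo_mem_nhdsGT hxb] with y hy using h y hy

theorem Polynomial.eval_nonpos_of_left {q : ℝ[X]} {a x : ℝ} (hax : a < x)
    (h : ∀ y ∈ Set.Ioo a x, q.eval y ≤ 0) : q.eval x ≤ 0 := by
  have hq : Filter.Tendsto (fun y => q.eval y) (𝓝[<] x) (𝓝 (q.eval x)) :=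
    (q.continuous.tendsto x).mono_left nhdsWithin_le_nhds
  refine le_of_tendsto hq ?_
  filter_upwards [Ioo_mem_nhdsLT hax] with y hy using h y hy

theorem Polynomial.derivative_nonneg_of_min_right {p : ℝ[X]} {x b : ℝ} (hxb : x < b)
    (h : ∀ y ∈ Set.Icc x b, p.eval x ≤ p.eval y) : 0 ≤ (derivative p).eval x := by
  obtain ⟨q, hq, hd⟩ := p.exists_eq_add_X_sub_C_mul x
  rw [hd]
  refine eval_nonneg_of_right hxb fun y hy => ?_
  have h1 := h y (Set.Ioo_subset_Icc_self hy)
  have h2 : p.eval y = p.eval x + (y - x) * q.eval y := by conv_lhs => rw [hq]; simp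
  rw [h2] at h1
  exact nonneg_of_mul_nonneg_right (by linarith) (sub_pos.mpr hy.1)

theorem Polynomial.derivative_nonpos_of_min_left {p : ℝ[X]} {a x : ℝ} (hax : a < x)
    (h : ∀ y ∈ Set.Icc a x, p.eval x ≤ p.eval y) : (derivative p).eval x ≤ 0 := by
  obtain ⟨q, hq, hd⟩ := p.exists_eq_add_X_sub_C_mul x
  rw [hd]
  refine eval_nonpos_of_left hax fun y hy => ?_
  have h1 := h y (Set.Ioo_subset_Icc_self hy)
  have h2 : p.eval y = p.eval x + (y - x) * q.eval y := by conv_lhs => rw [hq]; simp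
  rw [h2] at h1
  nlinarith [hy.2]

theorem Polynomial.derivative_eq_zero_of_min {p : ℝ[X]} {a x b : ℝ} (hx : x ∈ Set.Ioo a b)
    (h : ∀ y ∈ Set.Icc a b, p.eval x ≤ p.eval y) : (derivative p).eval x = 0 :=
  le_antisymm
    (derivative_nonpos_of_min_left hx.1 fun y hy => h y ⟨hy.1, hy.2.trans hx.2.le⟩)
    (derivative_nonneg_of_min_right hx.2 fun y hy => h y ⟨hx.1.le.trans hy.1, hy.2⟩)

theorem Polynomial.derivative_derivative_nonneg_of_min {p : ℝ[X]} {a x b : ℝ}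
    (hx : x ∈ Set.Ioo a b) (h : ∀ y ∈ Set.Icc a b, p.eval x ≤ p.eval y) :
    0 ≤ (derivative (derivative p)).eval x := by
  obtain ⟨q, hq, hd⟩ := p.exists_eq_add_X_sub_C_mul x
  obtain ⟨r, hr, hd'⟩ := q.exists_eq_add_X_sub_C_mul x
  have h0 : q.eval x = 0 := by rw [← hd, derivative_eq_zero_of_min hx h]
  have h2 : (derivative (derivative p)).eval x = 2 * r.eval x := by
    rw [← hd', hq]
    simp [two_mul]
  rw [h2]
  refine mul_nonneg zero_le_two (eval_nonneg_of_right hx.2 fun y hy => ?_)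
  have h1 := h y ⟨hx.1.le.trans hy.1.le, hy.2.le⟩
  have h3 : p.eval y = p.eval x + (y - x) ^ 2 * r.eval y := by
    conv_lhs => rw [hq, hr, h0]
    simp; ring
  rw [h3] at h1
  exact nonneg_of_mul_nonneg_right (by linarith) (pow_pos (sub_pos.mpr hy.1) 2)

/-! ### The Poisson extension and positivity of the Pitt multiplier. -/

/-- The Poisson extension `∑ α_n r ^ n C_n(x)` of `∑ α_n C_n`, at a fixed `x`, as a polynomial
in the radius `r`. -/
noncomputable def radialPoly {lam : ℝ} (hlam : 0 < lam) (x : ℝ) : ℝ[X] →ₗ[ℝ] ℝ[X] :=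
  (ultraPolyBasis hlam).constr ℝ (fun n => (ultraPoly lam n).eval x • X ^ n)

theorem radialPoly_ultraPoly {lam : ℝ} (hlam : 0 < lam) (x : ℝ) (n : ℕ) :
    radialPoly hlam x (ultraPoly lam n) = (ultraPoly lam n).eval x • X ^ n := by
  conv_lhs => rw [radialPoly, ← ultraPolyBasis_apply hlam, Module.Basis.constr_basis]

/-- The Poisson operator on polynomials. -/
noncomputable def poissonOp {lam : ℝ} (hlam : 0 < lam) (r : ℝ) : ℝ[X] →ₗ[ℝ] ℝ[X] :=
  ultraMultiplier hlam (fun n => r ^ n)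

theorem poissonOp_ultraPoly {lam : ℝ} (hlam : 0 < lam) (r : ℝ) (n : ℕ) :
    poissonOp hlam r (ultraPoly lam n) = r ^ n • ultraPoly lam n :=
  ultraMultiplier_ultraPoly _ _ _

theorem eval_radialPoly {lam : ℝ} (hlam : 0 < lam) (x r : ℝ) (f : ℝ[X]) :
    (radialPoly hlam x f).eval r = (poissonOp hlam r f).eval x := by
  induction f using ultraPoly_induction hlam with
  | hzero => simp
  | hadd f g h1 h2 => simp [h1, h2]
  | hsmul c f h => simp [h]
  | hbase n => simp [radialPoly_ultraPoly, poissonOp_ultraPoly, mul_comm]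

theorem X_mul_derivative_X_pow (n : ℕ) :
    (X : ℝ[X]) * derivative (X ^ n) = C (n : ℝ) * X ^ n := by
  cases n with
  | zero => simp
  | succ n => rw [derivative_X_pow, Nat.add_sub_cancel]; ring

/-- This is Laplace's equation for axially symmetric functions in "dimension" `2 lam + 2`, in polar
form: the radial part has eigenvalue `n (n + 2 lam)` on `r ^ n`, which cancels that of `C_n`. -/
theorem poisson_pde {lam : ℝ} (hlam : 0 < lam) (x r : ℝ) (f : ℝ[X]) :
    r ^ 2 * (derivative (derivative (radialPoly hlam x f))).eval r
      + (2 * lam + 1) * r * (derivative (radialPoly hlam x f)).eval r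
      + ((1 - x ^ 2) * (derivative (derivative (poissonOp hlam r f))).eval x
        - (2 * lam + 1) * x * (derivative (poissonOp hlam r f)).eval x) = 0 := by
  induction f using ultraPoly_induction hlam with
  | hzero => simp
  | hadd f g h1 h2 => simp only [map_add, eval_add]; linear_combination h1 + h2
  | hsmul c f h =>
    simp only [map_smul, eval_smul, smul_eq_mul]; linear_combination c * h
  | hbase n =>
    have h1 := congrArg (eval x) (ultraPoly_ode lam n)
    have h2 := X_mul_derivative_X_pow n
    have h3 := congrArg derivative h2
    rw [derivative_mul, derivative_mul, derivative_X, derivative_C] at h3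
    have h4 := congrArg (eval r) h2
    have h5 := congrArg (eval r) h3
    simp only [eval_add, eval_sub, eval_mul, eval_C, eval_X, eval_pow, eval_one, eval_zero] at h1 h4 h5
    simp only [radialPoly_ultraPoly, poissonOp_ultraPoly, derivative_smul, eval_smul, smul_eq_mul]
    linear_combination r ^ n * h1 + (ultraPoly lam n).eval x * (r * h5 + ((n : ℝ) + 2 * lam) * h4)

theorem continuous_eval_poissonOp {lam : ℝ} (hlam : 0 < lam) (f : ℝ[X]) :
    Continuous (fun p : ℝ × ℝ => (poissonOp hlam p.1 f).eval p.2) := by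
  induction f using ultraPoly_induction hlam with
  | hzero => simpa using continuous_const
  | hadd f g h1 h2 => simpa only [map_add, eval_add] using! h1.add h2
  | hsmul c f h => simpa using h.const_mul c
  | hbase n =>
    simp only [poissonOp_ultraPoly, eval_smul, smul_eq_mul]
    exact (continuous_fst.pow n).mul ((ultraPoly lam n).continuous.comp continuous_snd)

theorem poissonOp_one {lam : ℝ} (hlam : 0 < lam) (f : ℝ[X]) : poissonOp hlam 1 f = f := by
  induction f using ultraPoly_induction hlam with
  | hzero => simp
  | hadd f g h1 h2 => simp [h1, h2]
  | hsmul c f h => simp [h]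
  | hbase n => simp [poissonOp_ultraPoly]

theorem eval_poissonOp_zero {lam : ℝ} (hlam : 0 < lam) (f : ℝ[X]) (x : ℝ) :
    (poissonOp hlam 0 f).eval x * ultraIntegral (neg_half_lt_of_pos hlam) 1
      = ultraIntegral (neg_half_lt_of_pos hlam) f := by
  induction f using ultraPoly_induction hlam with
  | hzero => simp
  | hadd f g h1 h2 => simp [add_mul, h1, h2]
  | hsmul c f h => simp [mul_assoc, h]
  | hbase n =>
    rw [poissonOp_ultraPoly]
    rcases Nat.eq_zero_or_pos n with rfl | hn
    · simp [ultraPoly]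
    · have h := ultraIntegral_ultraPoly_mul_of_ne hlam hn.ne'
      rw [show ultraPoly lam 0 = 1 from rfl, mul_one] at h
      simp [h, hn.ne']

/-- At an endpoint the second-order term degenerates, and the first-order term has the right sign
because of the one-sided derivative. No boundary condition in `x` is therefore needed. -/
theorem ultraOperator_nonneg_of_min {lam : ℝ} (hlam : 0 < lam) {q : ℝ[X]} {x : ℝ}
    (hx : x ∈ Set.Icc (-1 : ℝ) 1) (h : ∀ y ∈ Set.Icc (-1 : ℝ) 1, q.eval x ≤ q.eval y) :
    0 ≤ (1 - x ^ 2) * (derivative (derivative q)).eval x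
      - (2 * lam + 1) * x * (derivative q).eval x := by
  rcases eq_or_lt_of_le hx.1 with h1 | h1
  · subst h1
    have := derivative_nonneg_of_min_right (by norm_num) h
    nlinarith
  rcases eq_or_lt_of_le hx.2 with h2 | h2
  · subst h2
    have := derivative_nonpos_of_min_left (by norm_num) h
    nlinarith
  rw [derivative_eq_zero_of_min ⟨h1, h2⟩ h, mul_zero, sub_zero]
  exact mul_nonneg (weight_nonneg hx) (derivative_derivative_nonneg_of_min ⟨h1, h2⟩ h)

/-- Minimum principle: subtracting `ε r ^ 2` from the harmonic extension makes it strictly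
superharmonic, so its minimum lies at `r = 0`, where the extension is the mean of `f`, or at `r =
1`, where it is `f`. -/
theorem poissonOp_nonneg {lam : ℝ} (hlam : 0 < lam) {f : ℝ[X]}
    (hf : ∀ x ∈ Set.Icc (-1 : ℝ) 1, 0 ≤ f.eval x) {r x : ℝ} (hr : r ∈ Set.Icc (0 : ℝ) 1)
    (hx : x ∈ Set.Icc (-1 : ℝ) 1) : 0 ≤ (poissonOp hlam r f).eval x := by
  refine le_of_forall_pos_sub_le fun ε hε => ?_
  have hcont : Continuous fun p : ℝ × ℝ => (poissonOp hlam p.1 f).eval p.2 - ε * p.1 ^ 2 :=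
    (continuous_eval_poissonOp hlam f).sub (by fun_prop)
  obtain ⟨⟨r₀, x₀⟩, ⟨hr₀, hx₀⟩, hmin⟩ :=
    (isCompact_Icc (a := (0 : ℝ)) (b := 1)).prod (isCompact_Icc (a := (-1 : ℝ)) (b := 1))
      |>.exists_isMinOn ⟨(r, x), hr, hx⟩ hcont.continuousOn
  have hmin' : ∀ s ∈ Set.Icc (0 : ℝ) 1, ∀ y ∈ Set.Icc (-1 : ℝ) 1,
      (poissonOp hlam r₀ f).eval x₀ - ε * r₀ ^ 2 ≤ (poissonOp hlam s f).eval y - ε * s ^ 2 :=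
    fun s hs y hy => isMinOn_iff.mp hmin (s, y) ⟨hs, hy⟩
  simp only at hr₀ hx₀
  suffices h : -ε ≤ (poissonOp hlam r₀ f).eval x₀ - ε * r₀ ^ 2 by
    have := hmin' r hr x hx
    nlinarith [sq_nonneg r]
  rcases eq_or_lt_of_le hr₀.1 with h0 | h0
  · subst h0
    have h1 := eval_poissonOp_zero hlam f x₀
    have h2 := ultraIntegral_nonneg (neg_half_lt_of_pos hlam) hf
    have h3 : 0 < ultraIntegral (neg_half_lt_of_pos hlam) 1 := by
      simpa using ultraIntegral_sq_pos (neg_half_lt_of_pos hlam) one_ne_zero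
    rw [← h1] at h2
    have h4 := nonneg_of_mul_nonneg_left h2 h3
    simp only [ne_eq, OfNat.ofNat_ne_zero, not_false_eq_true, zero_pow, mul_zero, sub_zero]
    linarith
  rcases eq_or_lt_of_le hr₀.2 with h1 | h1
  · subst h1
    rw [poissonOp_one]
    linarith [hf x₀ hx₀]
  -- For `0 < r₀ < 1` the radial conditions make the radial part at least `(4 lam + 4) ε r₀ ^ 2 > 0`
  -- and the angular part is nonnegative, yet they sum to zero.
  exfalso
  have hspace := ultraOperator_nonneg_of_min hlam (q := poissonOp hlam r₀ f) hx₀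
    fun y hy => by linarith [hmin' r₀ hr₀ y hy]
  have hrad : ∀ s ∈ Set.Icc (0 : ℝ) 1,
      (radialPoly hlam x₀ f - C ε * X ^ 2).eval r₀ ≤ (radialPoly hlam x₀ f - C ε * X ^ 2).eval s := by
    intro s hs
    simpa [eval_radialPoly] using hmin' s hs x₀ hx₀
  have hd1 := derivative_eq_zero_of_min ⟨h0, h1⟩ hrad
  have hd2 := derivative_derivative_nonneg_of_min ⟨h0, h1⟩ hrad
  simp at hd1 hd2
  have hpde := poisson_pde hlam x₀ r₀ f
  have e1 : (derivative (radialPoly hlam x₀ f)).eval r₀ = ε * (2 * r₀) := by linarith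
  rw [e1] at hpde
  have e2 := mul_le_mul_of_nonneg_left hd2 (sq_nonneg r₀)
  have e3 : 0 < ε * r₀ ^ 2 := by positivity
  nlinarith [mul_pos hlam e3]

/-- On `C_n` the integral is the Beta function of `n + lam + 1/2 - h` and `2 h`, which is `Γ(2h)`
times the multiplier. -/
theorem Gamma_mul_eval_pittMultiplier {lam h : ℝ} (hlam : 0 < lam) (h0 : 0 < h)
    (h1 : h < lam + 1 / 2) (f : ℝ[X]) (x : ℝ) :
    Real.Gamma (2 * h) * (ultraMultiplier hlam (pittMultiplier lam h) f).eval x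
      = ∫ r in (0 : ℝ)..1, r ^ (lam + 1 / 2 - h - 1) * (1 - r) ^ (2 * h - 1)
          * (poissonOp hlam r f).eval x := by
  have hint : ∀ f : ℝ[X], IntervalIntegrable (fun r : ℝ => r ^ (lam + 1 / 2 - h - 1)
      * (1 - r) ^ (2 * h - 1) * (poissonOp hlam r f).eval x) volume 0 1 := fun f =>
    (intervalIntegral_beta (a := lam + 1 / 2 - h) (b := 2 * h) (by linarith) (by linarith)).1
      |>.mul_continuousOn ((continuous_eval_poissonOp hlam f).comp
        (by fun_prop : Continuous fun r : ℝ => (r, x))).continuousOn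
  induction f using ultraPoly_induction hlam with
  | hzero => simp
  | hadd f g h1 h2 =>
    simp only [map_add, eval_add, mul_add]
    rw [h1, h2, intervalIntegral.integral_add (hint f) (hint g)]
  | hsmul c f h =>
    simp only [map_smul, eval_smul, smul_eq_mul]
    rw [mul_left_comm, h, ← intervalIntegral.integral_const_mul]
    congr 1; ext r; ring
  | hbase n =>
    have hn : (0 : ℝ) ≤ n := n.cast_nonneg
    have hb := (intervalIntegral_beta (a := n + lam + 1 / 2 - h) (b := 2 * h)
      (by linarith) (by linarith)).2
    simp only [ultraMultiplier_ultraPoly, poissonOp_ultraPoly, eval_smul, smul_eq_mul]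
    simp only [← mul_assoc]
    rw [intervalIntegral.integral_mul_const]
    congr 1
    rw [pittMultiplier, show (n : ℝ) + lam + 1 / 2 + h = n + lam + 1 / 2 - h + 2 * h by ring,
      ← mul_div_assoc, mul_comm, ← hb]
    refine intervalIntegral.integral_congr_Ioo_of_le zero_le_one fun r hr => ?_
    rw [show (n : ℝ) + lam + 1 / 2 - h - 1 = (lam + 1 / 2 - h - 1) + n by ring,
      Real.rpow_add_natCast hr.1.ne']
    ring

theorem eval_pittMultiplier_nonneg {lam h : ℝ} (hlam : 0 < lam) (h0 : 0 < h)
    (h1 : h < lam + 1 / 2) {f : ℝ[X]} (hf : ∀ x ∈ Set.Icc (-1 : ℝ) 1, 0 ≤ f.eval x) {x : ℝ}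
    (hx : x ∈ Set.Icc (-1 : ℝ) 1) :
    0 ≤ (ultraMultiplier hlam (pittMultiplier lam h) f).eval x := by
  have hG := Real.Gamma_pos_of_pos (s := 2 * h) (by linarith)
  refine nonneg_of_mul_nonneg_right ?_ hG
  rw [Gamma_mul_eval_pittMultiplier hlam h0 h1]
  refine intervalIntegral.integral_nonneg zero_le_one fun r hr => ?_
  have := poissonOp_nonneg hlam hf hr hx
  have := Real.rpow_nonneg hr.1 (lam + 1 / 2 - h - 1)
  have := Real.rpow_nonneg (sub_nonneg.mpr hr.2) (2 * h - 1)
  positivity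

/-! ### Orthonormal expansions and Parseval's identity. -/

/-- The normalized ultraspherical polynomial as a polynomial. -/
noncomputable def ultraBasisPoly (lam : ℝ) (n : ℕ) : ℝ[X] :=
  C (ultraNorm lam n)⁻¹ * ultraPoly lam n

theorem eval_ultraBasisPoly (lam : ℝ) (n : ℕ) (x : ℝ) :
    (ultraBasisPoly lam n).eval x = ultraBasis lam n x := by
  simp [ultraBasisPoly, ultraBasis]

theorem ultraNorm_sq {lam : ℝ} (hlam : 0 < lam) (n : ℕ) :
    ultraNorm lam n ^ 2 = ultraIntegral (neg_half_lt_of_pos hlam) (ultraPoly lam n ^ 2) := by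
  have h := ultraIntegral_sq_pos (neg_half_lt_of_pos hlam) (ultraPoly_ne_zero hlam n)
  rw [ultraIntegral_apply] at *
  simp only [eval_pow] at *
  rw [ultraNorm, Real.sq_sqrt h.le]

theorem ultraNorm_ne_zero {lam : ℝ} (hlam : 0 < lam) (n : ℕ) : ultraNorm lam n ≠ 0 := by
  have h := ultraIntegral_sq_pos (neg_half_lt_of_pos hlam) (ultraPoly_ne_zero hlam n)
  rw [← ultraNorm_sq hlam] at h
  intro h0
  simp [h0] at h

theorem ultraPoly_eq_ultraBasisPoly {lam : ℝ} (hlam : 0 < lam) (n : ℕ) :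
    ultraPoly lam n = ultraNorm lam n • ultraBasisPoly lam n := by
  rw [ultraBasisPoly, smul_eq_C_mul, ← mul_assoc, ← C_mul,
    mul_inv_cancel₀ (ultraNorm_ne_zero hlam n), C_1, one_mul]

theorem ultraIntegral_ultraBasisPoly_mul {lam : ℝ} (hlam : 0 < lam) (i j : ℕ) :
    ultraIntegral (neg_half_lt_of_pos hlam) (ultraBasisPoly lam i * ultraBasisPoly lam j)
      = if i = j then 1 else 0 := by
  have h : ultraBasisPoly lam i * ultraBasisPoly lam j
      = C ((ultraNorm lam i)⁻¹ * (ultraNorm lam j)⁻¹) * (ultraPoly lam i * ultraPoly lam j) := by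
    rw [ultraBasisPoly, ultraBasisPoly, C_mul]; ring
  rw [h, ultraIntegral_C_mul]
  split_ifs with hij
  · subst hij
    rw [← pow_two (ultraPoly lam i), ← ultraNorm_sq hlam]
    have := ultraNorm_ne_zero hlam i
    field_simp
  · rw [ultraIntegral_ultraPoly_mul_of_ne hlam hij, mul_zero]

theorem ultraCoeff_polynomial {lam : ℝ} (hlam : 0 < lam) (f : ℝ[X]) (n : ℕ) :
    ultraCoeff lam (fun x => f.eval x) n
      = ultraIntegral (neg_half_lt_of_pos hlam) (f * ultraBasisPoly lam n) := by
  simp only [ultraCoeff, ultraIntegral_apply, eval_mul, eval_ultraBasisPoly]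

/-- Allowing every cutoff beyond `M` lets expansions of different lengths be added or enlarged to a
prescribed length. -/
theorem exists_ultraBasisPoly_expansion {lam : ℝ} (hlam : 0 < lam) (f : ℝ[X]) :
    ∃ M : ℕ, ∀ N, M ≤ N → f = ∑ n ∈ Finset.range N,
      ultraIntegral (neg_half_lt_of_pos hlam) (f * ultraBasisPoly lam n) • ultraBasisPoly lam n := by
  induction f using ultraPoly_induction hlam with
  | hzero => exact ⟨0, fun N _ => by simp⟩
  | hadd f g h1 h2 =>
    obtain ⟨M1, h1⟩ := h1
    obtain ⟨M2, h2⟩ := h2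
    refine ⟨max M1 M2, fun N hN => ?_⟩
    simp only [add_mul, map_add, add_smul, Finset.sum_add_distrib]
    rw [← h1 N (le_trans (le_max_left _ _) hN), ← h2 N (le_trans (le_max_right _ _) hN)]
  | hsmul c f h =>
    obtain ⟨M, h⟩ := h
    refine ⟨M, fun N hN => ?_⟩
    simp only [smul_mul_assoc, map_smul, smul_assoc, ← Finset.smul_sum]
    rw [← h N hN]
  | hbase k =>
    refine ⟨k + 1, fun N hN => ?_⟩
    rw [Finset.sum_eq_single k]
    · conv_lhs => rw [ultraPoly_eq_ultraBasisPoly hlam]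
      rw [ultraPoly_eq_ultraBasisPoly hlam, smul_mul_assoc, map_smul,
        ultraIntegral_ultraBasisPoly_mul hlam, if_pos rfl, smul_eq_mul, mul_one]
    · intro n _ hn
      rw [ultraPoly_eq_ultraBasisPoly hlam, smul_mul_assoc, map_smul,
        ultraIntegral_ultraBasisPoly_mul hlam, if_neg hn.symm, smul_zero, zero_smul]
    · intro h
      simp at h
      omega

theorem ultraMultiplier_ultraBasisPoly {lam : ℝ} (hlam : 0 < lam) (m : ℕ → ℝ) (n : ℕ) :
    ultraMultiplier hlam m (ultraBasisPoly lam n) = m n • ultraBasisPoly lam n := by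
  rw [ultraBasisPoly, ← smul_eq_C_mul, map_smul, ultraMultiplier_ultraPoly, smul_comm]

theorem sum_multiplier_ultraCoeff_sq_le {lam : ℝ} (hlam : 0 < lam) {m : ℕ → ℝ}
    (hm : ∀ n, 0 ≤ m n) (f : ℝ[X]) (N : ℕ) :
    ∑ n ∈ Finset.range N, m n * ultraCoeff lam (fun x => f.eval x) n ^ 2
      ≤ ultraIntegral (neg_half_lt_of_pos hlam) (ultraMultiplier hlam m f * f) := by
  obtain ⟨M, hM⟩ := exists_ultraBasisPoly_expansion hlam f
  have h1 := hM (max M N) (le_max_left _ _)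
  have h2 : ultraIntegral (neg_half_lt_of_pos hlam) (ultraMultiplier hlam m f * f)
      = ∑ n ∈ Finset.range (max M N), m n * ultraCoeff lam (fun x => f.eval x) n ^ 2 := by
    conv_lhs => enter [2, 1]; rw [h1]
    rw [map_sum, Finset.sum_mul, map_sum]
    refine Finset.sum_congr rfl fun n _ => ?_
    rw [map_smul, ultraMultiplier_ultraBasisPoly, smul_mul_assoc, smul_mul_assoc, map_smul,
      map_smul, ultraCoeff_polynomial hlam, mul_comm (ultraBasisPoly lam n) f]
    simp only [smul_eq_mul]
    ring
  rw [h2]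
  exact Finset.sum_le_sum_of_subset_of_nonneg
    (Finset.range_subset_range.mpr (le_max_right _ _))
    fun n _ _ => mul_nonneg (hm n) (sq_nonneg _)

theorem memLp_polynomial {lam : ℝ} (hlam : 0 < lam) (f : ℝ[X]) :
    MemLp (fun x => f.eval x) 2 (ultraMeasure lam) := by
  rw [memLp_two_iff_integrable_sq f.continuous.aestronglyMeasurable]
  have h := integrable_ultraMeasure_polynomial (neg_half_lt_of_pos hlam) (f ^ 2)
  simp only [eval_pow] at h
  exact h

/-- Leaving `β` free serves two purposes: the Fourier coefficients give Bessel's inequality, and the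
coefficients of an approximating polynomial give Parseval. -/
theorem integral_sub_polynomial_sq {lam : ℝ} (hlam : 0 < lam) {u : ℝ → ℝ}
    (hu : MemLp u 2 (ultraMeasure lam)) (β : ℕ → ℝ) (N : ℕ) :
    ∫ x, (u x - (∑ n ∈ Finset.range N, β n • ultraBasisPoly lam n).eval x) ^ 2 ∂(ultraMeasure lam)
      = ∫ x, u x ^ 2 ∂(ultraMeasure lam) - ∑ n ∈ Finset.range N, ultraCoeff lam u n ^ 2
        + ∑ n ∈ Finset.range N, (ultraCoeff lam u n - β n) ^ 2 := by
  set f := ∑ n ∈ Finset.range N, β n • ultraBasisPoly lam n with hf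
  have hfL := memLp_polynomial hlam f
  have h1 : ∫ x, u x * f.eval x ∂(ultraMeasure lam)
      = ∑ n ∈ Finset.range N, β n * ultraCoeff lam u n := by
    simp only [hf, eval_finsetSum, Finset.mul_sum, eval_smul, smul_eq_mul, eval_ultraBasisPoly]
    rw [integral_finsetSum]
    · refine Finset.sum_congr rfl fun n _ => ?_
      rw [ultraCoeff, ← integral_const_mul]
      congr 1; ext x; ring
    · intro n _
      have := (hu.integrable_mul (memLp_polynomial hlam (ultraBasisPoly lam n))).const_mul (β n)
      refine this.congr (Filter.Eventually.of_forall fun x => ?_)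
      simp only [Pi.mul_apply, eval_ultraBasisPoly]
      ring
  have h2 : ∫ x, f.eval x ^ 2 ∂(ultraMeasure lam) = ∑ n ∈ Finset.range N, β n ^ 2 := by
    have : ∫ x, f.eval x ^ 2 ∂(ultraMeasure lam)
        = ultraIntegral (neg_half_lt_of_pos hlam) (f * f) := by
      simp [ultraIntegral_apply, pow_two]
    rw [this, hf, Finset.sum_mul, map_sum]
    refine Finset.sum_congr rfl fun n hn => ?_
    rw [Finset.mul_sum, map_sum, Finset.sum_eq_single n]
    · rw [smul_mul_smul_comm, map_smul, ultraIntegral_ultraBasisPoly_mul hlam, if_pos rfl]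
      simp [pow_two]
    · intro k _ hk
      rw [smul_mul_smul_comm, map_smul, ultraIntegral_ultraBasisPoly_mul hlam, if_neg hk.symm, smul_zero]
    · exact fun h => absurd hn h
  have h3 : ∀ x, (u x - f.eval x) ^ 2 = u x ^ 2 - 2 * (u x * f.eval x) + f.eval x ^ 2 :=
    fun x => by ring
  have i1 := hu.integrable_sq
  have i2 : Integrable (fun x => 2 * (u x * f.eval x)) (ultraMeasure lam) :=
    (hu.integrable_mul hfL).const_mul 2
  have i3 := hfL.integrable_sq
  have i4 : Integrable (fun x => u x ^ 2 - 2 * (u x * f.eval x)) (ultraMeasure lam) := i1.sub i2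
  simp only [h3]
  rw [integral_add i4 i3, integral_sub i1 i2, integral_const_mul, h1, h2, Finset.mul_sum,
    sub_add, sub_add, ← Finset.sum_sub_distrib, ← Finset.sum_sub_distrib]
  congr 1
  refine Finset.sum_congr rfl fun n _ => by ring

theorem sum_ultraCoeff_sq_le {lam : ℝ} (hlam : 0 < lam) {u : ℝ → ℝ}
    (hu : MemLp u 2 (ultraMeasure lam)) (N : ℕ) :
    ∑ n ∈ Finset.range N, ultraCoeff lam u n ^ 2 ≤ ∫ x, u x ^ 2 ∂(ultraMeasure lam) := by
  have h := integral_sub_polynomial_sq hlam hu (ultraCoeff lam u) N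
  have h0 : 0 ≤ ∫ x, (u x - (∑ n ∈ Finset.range N,
      ultraCoeff lam u n • ultraBasisPoly lam n).eval x) ^ 2 ∂(ultraMeasure lam) :=
    integral_nonneg fun x => sq_nonneg _
  simp only [sub_self, ne_eq, OfNat.ofNat_ne_zero, not_false_eq_true, zero_pow,
    Finset.sum_const_zero, add_zero] at h
  linarith

theorem ultraCoeff_sq_le {lam : ℝ} (hlam : 0 < lam) {u : ℝ → ℝ}
    (hu : MemLp u 2 (ultraMeasure lam)) (n : ℕ) :
    ultraCoeff lam u n ^ 2 ≤ ∫ x, u x ^ 2 ∂(ultraMeasure lam) :=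
  (Finset.single_le_sum (f := fun n => ultraCoeff lam u n ^ 2) (fun _ _ => sq_nonneg _)
    (Finset.self_mem_range_succ n)).trans (sum_ultraCoeff_sq_le hlam hu (n + 1))

theorem exists_polynomial_integral_sub_sq_le {lam : ℝ} (hlam : 0 < lam) {u : ℝ → ℝ}
    (hu : MemLp u 2 (ultraMeasure lam)) {ε : ℝ} (hε : 0 < ε) :
    ∃ f : ℝ[X], ∫ x, (u x - f.eval x) ^ 2 ∂(ultraMeasure lam) ≤ ε := by
  have := isFiniteMeasure_ultraMeasure (neg_half_lt_of_pos hlam)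
  obtain ⟨g, hg, hgL⟩ := MemLp.exists_boundedContinuous_integral_rpow_sub_le (p := 2) two_pos
    (by simpa using hu) (ε := ε / 4) (by positivity)
  set V := (ultraMeasure lam).real Set.univ
  have hV : 0 ≤ V := measureReal_nonneg
  obtain ⟨f, hf⟩ := exists_polynomial_near_of_continuousOn (-1) 1 g g.continuous.continuousOn
    (√(ε / (4 * (V + 1)))) (Real.sqrt_pos.mpr (by positivity))
  refine ⟨f, ?_⟩
  have hgL2 : MemLp g 2 (ultraMeasure lam) := by simpa using hgL
  have i1 : Integrable (fun x => 2 * (u x - g x) ^ 2) (ultraMeasure lam) :=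
    (hu.sub hgL2).integrable_sq.const_mul 2
  calc ∫ x, (u x - f.eval x) ^ 2 ∂(ultraMeasure lam)
      ≤ ∫ x, (2 * (u x - g x) ^ 2 + 2 * (ε / (4 * (V + 1)))) ∂(ultraMeasure lam) := by
        refine integral_mono_ae (hu.sub (memLp_polynomial hlam f)).integrable_sq
          (i1.add (integrable_const _)) ?_
        filter_upwards [ae_ultraMeasure_mem lam] with x hx
        have h1 := (hf x (Set.Ioo_subset_Icc_self hx)).le
        have h2 : (f.eval x - g x) ^ 2 ≤ ε / (4 * (V + 1)) := by
          rw [← sq_abs, ← Real.sq_sqrt (show 0 ≤ ε / (4 * (V + 1)) by positivity)]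
          gcongr
        nlinarith [sq_nonneg ((u x - g x) + (f.eval x - g x))]
    _ = 2 * ∫ x, (u x - g x) ^ 2 ∂(ultraMeasure lam) + V * (2 * (ε / (4 * (V + 1)))) := by
        rw [integral_add i1 (integrable_const _), integral_const_mul, integral_const, smul_eq_mul]
    _ ≤ 2 * (ε / 4) + ε / 2 := by
        gcongr
        · simpa using hg
        · rw [show V * (2 * (ε / (4 * (V + 1)))) = ε / 2 * (V / (V + 1)) by field_simp; ring]
          exact mul_le_of_le_one_right (by positivity) ((div_le_one (by positivity)).mpr (by linarith))
    _ = ε := by ring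

theorem hasSum_ultraCoeff_sq {lam : ℝ} (hlam : 0 < lam) {u : ℝ → ℝ}
    (hu : MemLp u 2 (ultraMeasure lam)) :
    HasSum (fun n => ultraCoeff lam u n ^ 2) (∫ x, u x ^ 2 ∂(ultraMeasure lam)) := by
  have hsum : Summable (fun n => ultraCoeff lam u n ^ 2) :=
    summable_of_sum_range_le (fun _ => sq_nonneg _) (sum_ultraCoeff_sq_le hlam hu)
  convert hsum.hasSum
  refine le_antisymm (le_of_forall_pos_le_add fun ε hε => ?_)
    (hsum.tsum_le_of_sum_range_le (sum_ultraCoeff_sq_le hlam hu))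
  obtain ⟨f, hf⟩ := exists_polynomial_integral_sub_sq_le hlam hu hε
  obtain ⟨M, hM⟩ := exists_ultraBasisPoly_expansion hlam f
  rw [hM M le_rfl, integral_sub_polynomial_sq hlam hu] at hf
  have h1 := hsum.sum_le_tsum (Finset.range M) fun _ _ => sq_nonneg _
  have h2 : 0 ≤ ∑ n ∈ Finset.range M, (ultraCoeff lam u n
      - ultraIntegral (neg_half_lt_of_pos hlam) (f * ultraBasisPoly lam n)) ^ 2 :=
    Finset.sum_nonneg fun _ _ => sq_nonneg _
  linarith

/-! ### The Schur test and Pitt's inequality. -/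

/-- For a symmetric kernel `K ≥ 0` this says that the double integral of `K(x, y) φ(x) φ(y) (w(x) -
w(y)) ^ 2` is nonnegative; symmetry identifies the two square terms. -/
theorem schur_test_pittMultiplier {lam h : ℝ} (hlam : 0 < lam) (h0 : 0 < h)
    (h1 : h < lam + 1 / 2) {φ : ℝ[X]} (hφ : ∀ x ∈ Set.Icc (-1 : ℝ) 1, 0 ≤ φ.eval x) (w : ℝ[X]) :
    ultraIntegral (neg_half_lt_of_pos hlam)
        (ultraMultiplier hlam (pittMultiplier lam h) (φ * w) * (φ * w))
      ≤ ultraIntegral (neg_half_lt_of_pos hlam)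
        (φ * ultraMultiplier hlam (pittMultiplier lam h) (φ * w ^ 2)) := by
  set A := ultraMultiplier hlam (pittMultiplier lam h)
  have key : 0 ≤ ultraIntegral (neg_half_lt_of_pos hlam)
      (φ * A (φ * w ^ 2) - (2 : ℝ) • (A (φ * w) * (φ * w)) + A φ * (φ * w ^ 2)) := by
    refine ultraIntegral_nonneg _ fun y hy => ?_
    -- Instead of a kernel: freeze `y`, apply the operator to `φ(y) φ (w - w(y)) ^ 2`, and evaluate
    -- the result at that same `y`.
    have h2 := eval_pittMultiplier_nonneg hlam h0 h1
      (f := φ.eval y • (φ * w ^ 2 - (2 * w.eval y) • (φ * w) + (w.eval y ^ 2) • φ))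
      (fun x hx => ?_) hy
    · change 0 ≤ (A _).eval y at h2
      simp only [map_smul, map_add, map_sub, eval_smul, eval_add, eval_sub, smul_eq_mul] at h2
      simp only [eval_add, eval_sub, eval_mul, eval_smul, eval_pow, smul_eq_mul]
      linarith
    · have e : (φ.eval y • (φ * w ^ 2 - (2 * w.eval y) • (φ * w) + (w.eval y ^ 2) • φ)).eval x
          = φ.eval y * (φ.eval x * (w.eval x - w.eval y) ^ 2) := by
        simp only [eval_smul, eval_add, eval_sub, eval_mul, eval_pow, smul_eq_mul]
        ring
      rw [e]
      exact mul_nonneg (hφ y hy) (mul_nonneg (hφ x hx) (sq_nonneg _))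
  have hsymm : ultraIntegral (neg_half_lt_of_pos hlam) (A φ * (φ * w ^ 2))
      = ultraIntegral (neg_half_lt_of_pos hlam) (φ * A (φ * w ^ 2)) :=
    ultraIntegral_multiplier_mul hlam _ _ _
  rw [map_add, map_sub, map_smul, hsymm, smul_eq_mul] at key
  linarith

/-- After the Schur test, positivity allows the outer factor `φ` to be replaced by the larger power
weight, on which the dual identity evaluates the integral exactly. -/
theorem pitt_step {lam h : ℝ} (hlam : 0 < lam) (h0 : 0 < h) (h1 : h < lam + 1 / 2)
    (hm : -1 / 2 < lam / 2 - 1 / 4 + h / 2) {φ : ℝ[X]}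
    (hφ : ∀ x ∈ Set.Icc (-1 : ℝ) 1, 0 ≤ φ.eval x)
    (hφ' : ∀ x ∈ Set.Ioo (-1 : ℝ) 1,
      φ.eval x ≤ (1 - x ^ 2) ^ (lam / 2 - 1 / 4 - h / 2 - lam)) (w : ℝ[X]) (N : ℕ) :
    ∑ n ∈ Finset.range N, pittMultiplier lam h n *
        ultraCoeff lam (fun x => (φ * w).eval x) n ^ 2
      ≤ pittConst lam h * ∫ x, (φ * w ^ 2).eval x ∂(ultraMeasure (lam / 2 - 1 / 4 + h / 2)) := by
  have hp : -1 / 2 < lam / 2 - 1 / 4 - h / 2 := by linarith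
  refine (sum_multiplier_ultraCoeff_sq_le hlam
    (fun n => (pittMultiplier_pos h0 h1 n).le) (φ * w) N).trans
    ((schur_test_pittMultiplier hlam h0 h1 hφ w).trans ?_)
  rw [← ultraIntegral_apply hm, ← ultraIntegral_pittMultiplier hlam h0 h1 hp hm,
    ultraIntegral_apply, ultraIntegral_apply,
    ← integral_ultraMeasure_eq_of_rpow (lam / 2 - 1 / 4 - h / 2) lam]
  refine integral_mono_ae (integrable_ultraMeasure_polynomial (neg_half_lt_of_pos hlam) _)
    ((integrable_ultraMeasure_rpow_iff _ _ _).mpr (integrable_ultraMeasure_polynomial hp _)) ?_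
  filter_upwards [ae_ultraMeasure_mem lam] with x hx
  rw [eval_mul]
  refine mul_le_mul_of_nonneg_right (hφ' x hx) ?_
  refine eval_pittMultiplier_nonneg hlam h0 h1 (fun y hy => ?_) (Set.Ioo_subset_Icc_self hx)
  rw [eval_mul, eval_pow]
  exact mul_nonneg (hφ y hy) (sq_nonneg _)

theorem tendsto_integral_ultraMeasure {s : ℝ} (hs : -1 / 2 < s) {F : ℕ → ℝ → ℝ} {G : ℝ → ℝ} (B : ℝ)
    (hF : ∀ k, Measurable (F k)) (hB : ∀ k, ∀ x ∈ Set.Ioo (-1 : ℝ) 1, |F k x| ≤ B)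
    (hlim : ∀ x ∈ Set.Ioo (-1 : ℝ) 1, Filter.Tendsto (fun k => F k x) Filter.atTop (𝓝 (G x))) :
    Filter.Tendsto (fun k => ∫ x, F k x ∂(ultraMeasure s)) Filter.atTop
      (𝓝 (∫ x, G x ∂(ultraMeasure s))) := by
  have := isFiniteMeasure_ultraMeasure hs
  refine tendsto_integral_of_dominated_convergence (fun _ => B)
    (fun k => (hF k).aestronglyMeasurable) (integrable_const B) (fun k => ?_) ?_
  · filter_upwards [ae_ultraMeasure_mem s] with x hx using hB k x hx
  · filter_upwards [ae_ultraMeasure_mem s] with x hx using hlim x hx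

theorem pitt_polynomial_weight {lam h : ℝ} (hlam : 0 < lam) (h0 : 0 < h) (h1 : h < lam + 1 / 2)
    (hm : -1 / 2 < lam / 2 - 1 / 4 + h / 2) {φ : ℝ[X]}
    (hφ : ∀ x ∈ Set.Icc (-1 : ℝ) 1, 0 < φ.eval x)
    (hφ' : ∀ x ∈ Set.Ioo (-1 : ℝ) 1,
      φ.eval x ≤ (1 - x ^ 2) ^ (lam / 2 - 1 / 4 - h / 2 - lam)) (u : ℝ[X]) (N : ℕ) :
    ∑ n ∈ Finset.range N, pittMultiplier lam h n * ultraCoeff lam (fun x => u.eval x) n ^ 2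
      ≤ pittConst lam h *
        ∫ x, u.eval x ^ 2 / φ.eval x ∂(ultraMeasure (lam / 2 - 1 / 4 + h / 2)) := by
  have hcont : ContinuousOn (fun x => u.eval x / φ.eval x) (Set.Icc (-1) 1) :=
    u.continuous.continuousOn.div φ.continuous.continuousOn fun x hx => (hφ x hx).ne'
  -- The quotient `u / φ` is the wanted `w` but need not be a polynomial; Weierstrass approximants
  -- make `φ * w k` tend to `u` and `φ * w k ^ 2` to `u ^ 2 / φ`.
  choose w hw using fun k : ℕ => exists_polynomial_near_of_continuousOn (-1) 1 _ hcont
    (1 / ((k : ℝ) + 1)) (by positivity)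
  obtain ⟨B, hB⟩ := isCompact_Icc.exists_bound_of_continuousOn hcont
  obtain ⟨D, hD⟩ := isCompact_Icc.exists_bound_of_continuousOn
    (s := Set.Icc (-1 : ℝ) 1) φ.continuous.continuousOn
  have hwB : ∀ k, ∀ x ∈ Set.Ioo (-1 : ℝ) 1, |(w k).eval x| ≤ B + 1 := by
    intro k x hx
    have hx' := Set.Ioo_subset_Icc_self hx
    have e1 := (hw k x hx').le
    have e2 := hB x hx'
    have e3 : 1 / ((k : ℝ) + 1) ≤ 1 := by
      rw [div_le_one (by positivity)]; linarith [k.cast_nonneg (α := ℝ)]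
    rw [Real.norm_eq_abs] at e2
    have e4 := abs_add_le ((w k).eval x - u.eval x / φ.eval x) (u.eval x / φ.eval x)
    rw [sub_add_cancel] at e4
    linarith
  have hwlim : ∀ x ∈ Set.Ioo (-1 : ℝ) 1,
      Filter.Tendsto (fun k => (w k).eval x) Filter.atTop (𝓝 (u.eval x / φ.eval x)) := by
    intro x hx
    rw [tendsto_iff_dist_tendsto_zero]
    exact squeeze_zero (fun _ => dist_nonneg)
      (fun k => (hw k x (Set.Ioo_subset_Icc_self hx)).le) tendsto_one_div_add_atTop_nhds_zero_nat
  have hφne : ∀ x ∈ Set.Ioo (-1 : ℝ) 1, φ.eval x ≠ 0 :=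
    fun x hx => (hφ x (Set.Ioo_subset_Icc_self hx)).ne'
  have hcoef : ∀ n, Filter.Tendsto (fun k => ultraCoeff lam (fun x => (φ * w k).eval x) n)
      Filter.atTop (𝓝 (ultraCoeff lam (fun x => u.eval x) n)) := by
    intro n
    obtain ⟨E, hE⟩ := isCompact_Icc.exists_bound_of_continuousOn
      (s := Set.Icc (-1 : ℝ) 1) (ultraBasisPoly lam n).continuous.continuousOn
    refine tendsto_integral_ultraMeasure (neg_half_lt_of_pos hlam) (D * (B + 1) * E)
      (fun k => ?_) (fun k x hx => ?_) fun x hx => ?_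
    · simp only [← eval_ultraBasisPoly, ← eval_mul]
      exact (Polynomial.continuous _).measurable
    · have hx' := Set.Ioo_subset_Icc_self hx
      have e1 := hD x hx'
      have e2 := hwB k x hx
      have e3 := hE x hx'
      rw [Real.norm_eq_abs] at e1 e3
      beta_reduce
      rw [← eval_ultraBasisPoly, eval_mul, abs_mul, abs_mul]
      have := (abs_nonneg _).trans e1
      have := (abs_nonneg _).trans e2
      gcongr
    · have := ((hwlim x hx).const_mul (φ.eval x)).mul_const (ultraBasis lam n x)
      rw [mul_div_cancel₀ _ (hφne x hx)] at this
      simpa only [eval_mul] using this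
  have hint : Filter.Tendsto
      (fun k => ∫ x, (φ * w k ^ 2).eval x ∂(ultraMeasure (lam / 2 - 1 / 4 + h / 2)))
      Filter.atTop
      (𝓝 (∫ x, u.eval x ^ 2 / φ.eval x ∂(ultraMeasure (lam / 2 - 1 / 4 + h / 2)))) := by
    refine tendsto_integral_ultraMeasure hm (D * (B + 1) ^ 2)
      (fun k => (Polynomial.continuous _).measurable) (fun k x hx => ?_) fun x hx => ?_
    · have e1 := hD x (Set.Ioo_subset_Icc_self hx)
      have e2 := hwB k x hx
      rw [Real.norm_eq_abs] at e1
      rw [eval_mul, eval_pow, abs_mul, abs_pow]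
      have := (abs_nonneg _).trans e1
      gcongr
    · have := ((hwlim x hx).pow 2).const_mul (φ.eval x)
      rw [show φ.eval x * (u.eval x / φ.eval x) ^ 2 = u.eval x ^ 2 / φ.eval x by
        have := hφne x hx
        field_simp] at this
      simpa only [eval_mul, eval_pow] using this
  exact le_of_tendsto_of_tendsto'
    (tendsto_finsetSum _ fun n _ => ((hcoef n).pow 2).const_mul (pittMultiplier lam h n))
    (hint.const_mul _)
    fun k => pitt_step hlam h0 h1 hm (fun x hx => (hφ x hx).le) hφ' (w k) N

theorem exists_polynomial_approx_rpow {a : ℝ} (ha : 0 < a) :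
    ∃ (δ : ℝ) (φ : ℕ → ℝ[X]), 0 < δ ∧
      (∀ k, ∀ x ∈ Set.Icc (-1 : ℝ) 1, δ ≤ (φ k).eval x) ∧
      (∀ k, ∀ x ∈ Set.Ioo (-1 : ℝ) 1, (φ k).eval x ≤ (1 - x ^ 2) ^ (-a)) ∧
      ∀ x ∈ Set.Ioo (-1 : ℝ) 1,
        Filter.Tendsto (fun k => (φ k).eval x) Filter.atTop (𝓝 ((1 - x ^ 2) ^ (-a))) := by
  -- For `0 < η ≤ 1` the regularized base `1 - x ^ 2 + η` is at most `2`, so its power is at least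
  -- `4 δ`; the shift and the approximation error cost at most `2 δ`.
  set δ : ℝ := 2 ^ (-a) / 4 with hδ
  have hδ0 : 0 < δ := by positivity
  have hη : ∀ k : ℕ, 0 < 1 / ((k : ℝ) + 1) := fun k => by positivity
  have hη1 : ∀ k : ℕ, 1 / ((k : ℝ) + 1) ≤ 1 := fun k => by
    rw [div_le_one (by positivity)]; linarith [k.cast_nonneg (α := ℝ)]
  -- The downward shift equals the tolerance of the approximation below, so the approximants stay
  -- under the singular power.
  have hcont : ∀ k : ℕ, ContinuousOn
      (fun x : ℝ => (1 - x ^ 2 + 1 / ((k : ℝ) + 1)) ^ (-a) - δ * (1 / ((k : ℝ) + 1)))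
      (Set.Icc (-1) 1) := by
    intro k
    refine ContinuousOn.sub (ContinuousOn.rpow_const (by fun_prop) fun x hx => Or.inl ?_)
      continuousOn_const
    have := weight_nonneg hx
    linarith [hη k]
  choose φ hφ using fun k : ℕ => exists_polynomial_near_of_continuousOn (-1) 1 _ (hcont k)
    (δ * (1 / ((k : ℝ) + 1))) (mul_pos hδ0 (hη k))
  refine ⟨δ, φ, hδ0, fun k x hx => ?_, fun k x hx => ?_, fun x hx => ?_⟩
  · have h1 := (abs_lt.mp (hφ k x hx)).1
    have h2 : (2 : ℝ) ^ (-a) ≤ (1 - x ^ 2 + 1 / ((k : ℝ) + 1)) ^ (-a) := by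
      refine Real.rpow_le_rpow_of_nonpos ?_ ?_ (by linarith)
      · linarith [weight_nonneg hx, hη k]
      · nlinarith [hη1 k]
    have h3 : δ * (1 / ((k : ℝ) + 1)) ≤ δ := mul_le_of_le_one_right hδ0.le (hη1 k)
    linarith
  · have h1 := (abs_lt.mp (hφ k x (Set.Ioo_subset_Icc_self hx))).2
    have h2 : (1 - x ^ 2 + 1 / ((k : ℝ) + 1)) ^ (-a) ≤ (1 - x ^ 2) ^ (-a) :=
      Real.rpow_le_rpow_of_nonpos (weight_pos hx) (by linarith [hη k]) (by linarith)
    linarith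
  · have hlim0 : Filter.Tendsto (fun k : ℕ => 1 / ((k : ℝ) + 1)) Filter.atTop (𝓝 0) :=
      tendsto_one_div_add_atTop_nhds_zero_nat
    have hlim1 : Filter.Tendsto (fun k : ℕ => (1 - x ^ 2 + 1 / ((k : ℝ) + 1)) ^ (-a))
        Filter.atTop (𝓝 ((1 - x ^ 2) ^ (-a))) := by
      have := (hlim0.const_add (1 - x ^ 2)).rpow_const (p := -a)
        (Or.inl (by rw [add_zero]; exact (weight_pos hx).ne'))
      rwa [add_zero] at this
    have hlim2 := hlim0.const_mul δ
    rw [mul_zero] at hlim2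
    have hlow := hlim1.sub (hlim2.const_mul 2)
    rw [mul_zero, sub_zero] at hlow
    refine tendsto_of_tendsto_of_tendsto_of_le_of_le hlow hlim1 (fun k => ?_) fun k => ?_
    · have h1 := (abs_lt.mp (hφ k x (Set.Ioo_subset_Icc_self hx))).1
      simp only
      linarith
    · have h1 := (abs_lt.mp (hφ k x (Set.Ioo_subset_Icc_self hx))).2
      simp only
      linarith

theorem pitt_polynomial {lam h : ℝ} (hlam : 0 < lam) (h0 : 0 < h) (h1 : h < lam + 1 / 2)
    (u : ℝ[X]) (N : ℕ) :
    ∑ n ∈ Finset.range N, pittMultiplier lam h n * ultraCoeff lam (fun x => u.eval x) n ^ 2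
      ≤ pittConst lam h * ∫ x, (1 - x ^ 2) ^ h * u.eval x ^ 2 ∂(ultraMeasure lam) := by
  have hm : -1 / 2 < lam / 2 - 1 / 4 + h / 2 := by linarith
  obtain ⟨δ, φ, hδ, hlow, hup, hlim⟩ :=
    exists_polynomial_approx_rpow (a := lam / 2 + 1 / 4 + h / 2) (by linarith)
  have e : -(lam / 2 + 1 / 4 + h / 2) = lam / 2 - 1 / 4 - h / 2 - lam := by ring
  rw [e] at hup hlim
  obtain ⟨B, hB⟩ := isCompact_Icc.exists_bound_of_continuousOn
    (s := Set.Icc (-1 : ℝ) 1) (u ^ 2).continuous.continuousOn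
  have hint : Filter.Tendsto
      (fun k => ∫ x, u.eval x ^ 2 / (φ k).eval x ∂(ultraMeasure (lam / 2 - 1 / 4 + h / 2)))
      Filter.atTop (𝓝 (∫ x, u.eval x ^ 2 / (1 - x ^ 2) ^ (lam / 2 - 1 / 4 - h / 2 - lam)
        ∂(ultraMeasure (lam / 2 - 1 / 4 + h / 2)))) := by
    refine tendsto_integral_ultraMeasure hm (B / δ) (fun k => ?_) (fun k x hx => ?_) fun x hx => ?_
    · exact (u.continuous.measurable.pow_const 2).div (φ k).continuous.measurable
    · have hx' := Set.Ioo_subset_Icc_self hx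
      have e1 := hB x hx'
      have e2 := hlow k x hx'
      rw [Real.norm_eq_abs, eval_pow] at e1
      rw [abs_div, abs_of_pos (hδ.trans_le e2)]
      have := (abs_nonneg _).trans e1
      gcongr
    · exact tendsto_const_nhds.div (hlim x hx) (Real.rpow_pos_of_pos (weight_pos hx) _).ne'
  have hval : ∫ x, u.eval x ^ 2 / (1 - x ^ 2) ^ (lam / 2 - 1 / 4 - h / 2 - lam)
        ∂(ultraMeasure (lam / 2 - 1 / 4 + h / 2))
      = ∫ x, (1 - x ^ 2) ^ h * u.eval x ^ 2 ∂(ultraMeasure lam) := by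
    rw [← integral_ultraMeasure_eq_of_rpow _ lam]
    refine integral_congr_ae ?_
    filter_upwards [ae_ultraMeasure_mem lam] with x hx
    rw [div_eq_mul_inv (u.eval x ^ 2), ← Real.rpow_neg (weight_pos hx).le,
      mul_comm (u.eval x ^ 2), ← mul_assoc,
      ← Real.rpow_add (weight_pos hx)]
    congr 2; ring
  rw [hval] at hint
  exact ge_of_tendsto' (hint.const_mul _) fun k =>
    pitt_polynomial_weight hlam h0 h1 hm (fun x hx => hδ.trans_le (hlow k x hx)) (hup k) u N

theorem rpow_weight_le_one {h : ℝ} (h0 : 0 < h) {x : ℝ} (hx : x ∈ Set.Ioo (-1 : ℝ) 1) :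
    (1 - x ^ 2) ^ h ≤ 1 :=
  Real.rpow_le_one (weight_pos hx).le (by nlinarith [sq_nonneg x]) h0.le

theorem integrable_rpow_weight_mul_sq {lam h : ℝ} (h0 : 0 < h) {u : ℝ → ℝ}
    (hu : MemLp u 2 (ultraMeasure lam)) :
    Integrable (fun x => (1 - x ^ 2) ^ h * u x ^ 2) (ultraMeasure lam) := by
  refine hu.integrable_sq.bdd_mul (c := 1) (measurable_ultraWeight h).aestronglyMeasurable ?_
  filter_upwards [ae_ultraMeasure_mem lam] with x hx
  rw [Real.norm_eq_abs, abs_of_nonneg (Real.rpow_nonneg (weight_pos hx).le _)]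
  exact rpow_weight_le_one h0 hx

theorem pitt_inequality {lam h : ℝ} (hlam : 0 < lam) (h0 : 0 < h) (h1 : h < lam + 1 / 2)
    {u : ℝ → ℝ} (hu : MemLp u 2 (ultraMeasure lam)) (N : ℕ) :
    ∑ n ∈ Finset.range N, pittMultiplier lam h n * ultraCoeff lam u n ^ 2
      ≤ pittConst lam h * ∫ x, (1 - x ^ 2) ^ h * u x ^ 2 ∂(ultraMeasure lam) := by
  have hlam' := neg_half_lt_of_pos hlam
  choose f hf using fun k : ℕ => exists_polynomial_integral_sub_sq_le hlam hu
    (ε := 1 / ((k : ℝ) + 1)) (by positivity)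
  have hlim0 : Filter.Tendsto (fun k : ℕ => 1 / ((k : ℝ) + 1)) Filter.atTop (𝓝 0) :=
    tendsto_one_div_add_atTop_nhds_zero_nat
  have hfL := fun k => memLp_polynomial hlam (f k)
  have hcoef : ∀ n, Filter.Tendsto (fun k => ultraCoeff lam (fun x => (f k).eval x) n)
      Filter.atTop (𝓝 (ultraCoeff lam u n)) := by
    intro n
    rw [tendsto_iff_dist_tendsto_zero]
    have hsqrt := (Real.continuous_sqrt.tendsto 0).comp hlim0
    rw [Real.sqrt_zero] at hsqrt
    refine squeeze_zero (fun _ => dist_nonneg) (fun k => ?_) hsqrt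
    rw [dist_comm, Real.dist_eq]
    refine Real.abs_le_sqrt ?_
    have e1 := ultraCoeff_sq_le hlam (hu.sub (hfL k)) n
    have e2 : ultraCoeff lam (u - fun x => (f k).eval x) n
        = ultraCoeff lam u n - ultraCoeff lam (fun x => (f k).eval x) n := by
      have hb := memLp_polynomial hlam (ultraBasisPoly lam n)
      simp only [eval_ultraBasisPoly] at hb
      have j1 : Integrable (fun x => u x * ultraBasis lam n x) (ultraMeasure lam) :=
        hu.integrable_mul hb
      have j2 : Integrable (fun x => (f k).eval x * ultraBasis lam n x) (ultraMeasure lam) :=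
        (hfL k).integrable_mul hb
      rw [ultraCoeff, ultraCoeff, ultraCoeff, ← integral_sub j1 j2]
      simp only [Pi.sub_apply, sub_mul]
    rw [e2] at e1
    exact e1.trans (hf k)
  set I := ∫ x, (1 - x ^ 2) ^ h * u x ^ 2 ∂(ultraMeasure lam) with hI
  have hc := pittConst_pos h0 h1
  -- Weighted Young inequality: `f ^ 2 ≤ (1 + ε) u ^ 2 + (1 + 1/ε) (u - f) ^ 2`. As the weight is at
  -- most `1`, the last term is controlled by the `L²` error alone.
  have hsum : ∀ ε : ℝ, 0 < ε → ∑ n ∈ Finset.range N, pittMultiplier lam h n *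
      ultraCoeff lam u n ^ 2 ≤ pittConst lam h * ((1 + ε) * I) := by
    intro ε hε
    have hbound : ∀ k : ℕ, ∫ x, (1 - x ^ 2) ^ h * (f k).eval x ^ 2 ∂(ultraMeasure lam)
        ≤ (1 + ε) * I + (1 + 1 / ε) * (1 / ((k : ℝ) + 1)) := by
      intro k
      have i1 := integrable_rpow_weight_mul_sq h0 hu
      have i2 : Integrable (fun x => (u x - (f k).eval x) ^ 2) (ultraMeasure lam) :=
        (hu.sub (hfL k)).integrable_sq
      have e1 : ∫ x, (1 - x ^ 2) ^ h * (f k).eval x ^ 2 ∂(ultraMeasure lam)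
          ≤ ∫ x, ((1 + ε) * ((1 - x ^ 2) ^ h * u x ^ 2)
            + (1 + 1 / ε) * (u x - (f k).eval x) ^ 2) ∂(ultraMeasure lam) := by
        refine integral_mono_ae (integrable_rpow_weight_mul_sq h0 (hfL k))
          ((i1.const_mul _).add (i2.const_mul _)) ?_
        filter_upwards [ae_ultraMeasure_mem lam] with x hx
        have hw0 := (Real.rpow_pos_of_pos (weight_pos hx) h).le
        have hw1 := rpow_weight_le_one h0 hx
        have hsq : (f k).eval x ^ 2 ≤ (1 + ε) * u x ^ 2 + (1 + 1 / ε) * (u x - (f k).eval x) ^ 2 := by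
          have : (1 + ε) * u x ^ 2 + (1 + 1 / ε) * (u x - (f k).eval x) ^ 2 - (f k).eval x ^ 2
              = (ε * u x + (u x - (f k).eval x)) ^ 2 / ε := by
            field_simp
            ring
          have h5 : 0 ≤ (ε * u x + (u x - (f k).eval x)) ^ 2 / ε := by positivity
          linarith
        have h6 : 0 ≤ (1 + 1 / ε) * (u x - (f k).eval x) ^ 2 := by positivity
        calc (1 - x ^ 2) ^ h * (f k).eval x ^ 2
            ≤ (1 - x ^ 2) ^ h * ((1 + ε) * u x ^ 2 + (1 + 1 / ε) * (u x - (f k).eval x) ^ 2) := by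
              gcongr
          _ = (1 + ε) * ((1 - x ^ 2) ^ h * u x ^ 2)
              + (1 - x ^ 2) ^ h * ((1 + 1 / ε) * (u x - (f k).eval x) ^ 2) := by ring
          _ ≤ _ := add_le_add le_rfl (mul_le_of_le_one_left h6 hw1)
      rw [integral_add (i1.const_mul _) (i2.const_mul _), integral_const_mul,
        integral_const_mul] at e1
      refine e1.trans ?_
      gcongr
      exact hf k
    have hlim1 := ((hlim0.const_mul (1 + 1 / ε)).const_add ((1 + ε) * I)).const_mul (pittConst lam h)
    rw [mul_zero, add_zero] at hlim1
    refine le_of_tendsto_of_tendsto'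
      (tendsto_finsetSum _ fun n _ => ((hcoef n).pow 2).const_mul (pittMultiplier lam h n)) hlim1
      fun k => (pitt_polynomial hlam h0 h1 (f k) N).trans ?_
    gcongr
    exact hbound k
  have hlim2 : Filter.Tendsto (fun k : ℕ => pittConst lam h * ((1 + 1 / ((k : ℝ) + 1)) * I))
      Filter.atTop (𝓝 (pittConst lam h * I)) := by
    have := ((hlim0.const_add 1).mul_const I).const_mul (pittConst lam h)
    rwa [add_zero, one_mul] at this
  exact ge_of_tendsto' hlim2 fun k => hsum _ (by positivity)

/-! ### Bounds for Gamma quotients and the digamma function. -/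

theorem hasDerivAt_log_Gamma {z : ℝ} (hz : 0 < z) :
    HasDerivAt (fun x => Real.log (Real.Gamma x)) (realDigamma z) z :=
  (Real.differentiableAt_Gamma fun m => by
    have : (0 : ℝ) ≤ m := m.cast_nonneg
    linarith).hasDerivAt.log (Real.Gamma_pos_of_pos hz).ne'

/-- The difference `log (a + y) - log (a - y)` is an odd power series in `y / a` with nonnegative
coefficients, and `t ^ (2k + 1) ≤ t` on `[0, 1]`. -/
theorem log_add_sub_log_sub_mul_le {a h t : ℝ} (h0 : 0 ≤ h) (hha : h < a) (ht0 : 0 ≤ t)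
    (ht1 : t ≤ 1) :
    Real.log (a + t * h) - Real.log (a - t * h) ≤ t * (Real.log (a + h) - Real.log (a - h)) := by
  have ha : 0 < a := h0.trans_lt hha
  have key : ∀ y : ℝ, 0 ≤ y → y < a →
      HasSum (fun k : ℕ => (2 : ℝ) * (1 / (2 * k + 1)) * (y / a) ^ (2 * k + 1))
        (Real.log (a + y) - Real.log (a - y)) := by
    intro y hy0 hya
    have h1 : |y / a| < 1 := by
      rw [abs_of_nonneg (by positivity), div_lt_one ha]; exact hya
    convert Real.hasSum_log_sub_log_of_abs_lt_one h1 using 1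
    rw [← Real.log_div (by linarith) (by linarith), ← Real.log_div
      (by have : 0 ≤ y / a := by positivity
          linarith)
      (by linarith [abs_lt.mp h1])]
    congr 1
    have : a - y ≠ 0 := by linarith
    have : 1 - y / a ≠ 0 := by linarith [abs_lt.mp h1]
    field_simp
  have hth : t * h ≤ h := mul_le_of_le_one_left h0 ht1
  refine hasSum_le (fun k => ?_) (key (t * h) (by positivity) (by linarith))
    ((key h h0 hha).mul_left t)
  have h2 : t ^ (2 * k + 1) ≤ t := by
    simpa using pow_le_pow_of_le_one ht0 ht1 (Nat.le_add_left 1 (2 * k))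
  have h3 : 0 ≤ (2 : ℝ) * (1 / (2 * k + 1)) * (h / a) ^ (2 * k + 1) := by positivity
  rw [mul_div_assoc, mul_pow]
  nlinarith [mul_le_mul_of_nonneg_right h2 h3]

/-- In Euler's limit formula for `log Γ` the logarithms enter with a minus sign, so the previous
inequality reverses; the `log n` term is linear in the increment and cancels. -/
theorem mul_log_Gamma_sub_le {z h t : ℝ} (h0 : 0 ≤ h) (hhz : h < z) (ht0 : 0 ≤ t) (ht1 : t ≤ 1) :
    t * (Real.log (Real.Gamma (z + h)) - Real.log (Real.Gamma (z - h)))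
      ≤ Real.log (Real.Gamma (z + t * h)) - Real.log (Real.Gamma (z - t * h)) := by
  have hth : t * h ≤ h := mul_le_of_le_one_left h0 ht1
  have hth0 : 0 ≤ t * h := by positivity
  have lim : ∀ x : ℝ, 0 < x → Filter.Tendsto (Real.BohrMollerup.logGammaSeq x) Filter.atTop
      (𝓝 (Real.log (Real.Gamma x))) := fun x hx => Real.BohrMollerup.tendsto_log_gamma hx
  refine le_of_tendsto_of_tendsto'
    (((lim (z + h) (by linarith)).sub (lim (z - h) (by linarith))).const_mul t)
    ((lim (z + t * h) (by linarith)).sub (lim (z - t * h) (by linarith))) fun n => ?_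
  have e : ∀ y : ℝ, Real.BohrMollerup.logGammaSeq (z + y) n
      - Real.BohrMollerup.logGammaSeq (z - y) n = 2 * y * Real.log n
        - ∑ m ∈ Finset.range (n + 1), (Real.log (z + m + y) - Real.log (z + m - y)) := by
    intro y
    simp only [Real.BohrMollerup.logGammaSeq, Finset.sum_sub_distrib, add_right_comm z y,
      sub_add_eq_add_sub]
    ring
  rw [e, e, mul_sub, Finset.mul_sum]
  have hs : ∑ m ∈ Finset.range (n + 1), (Real.log (z + m + t * h) - Real.log (z + m - t * h))
      ≤ ∑ m ∈ Finset.range (n + 1), t * (Real.log (z + m + h) - Real.log (z + m - h)) :=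
    Finset.sum_le_sum fun m _ => log_add_sub_log_sub_mul_le h0
      (by linarith [m.cast_nonneg (α := ℝ)]) ht0 ht1
  linarith

/-- Divide the previous inequality by `t` and let `t` decrease to `0`. -/
theorem log_Gamma_sub_le_digamma {z h : ℝ} (h0 : 0 ≤ h) (hhz : h < z) :
    Real.log (Real.Gamma (z + h)) - Real.log (Real.Gamma (z - h)) ≤ 2 * h * realDigamma z := by
  have hz : 0 < z := h0.trans_lt hhz
  set F : ℝ → ℝ := fun t =>
    Real.log (Real.Gamma (z + t * h)) - Real.log (Real.Gamma (z - t * h)) with hF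
  have hd : HasDerivAt F (2 * h * realDigamma z) 0 := by
    have hl : HasDerivAt (fun t : ℝ => t * h) h 0 := by simpa using (hasDerivAt_id (0 : ℝ)).mul_const h
    have d1 := HasDerivAt.comp (𝕜 := ℝ) 0 (h₂ := fun x => Real.log (Real.Gamma x))
      (by rw [zero_mul, add_zero]; exact hasDerivAt_log_Gamma hz) (hl.const_add z)
    have d2 := HasDerivAt.comp (𝕜 := ℝ) 0 (h₂ := fun x => Real.log (Real.Gamma x))
      (by rw [zero_mul, sub_zero]; exact hasDerivAt_log_Gamma hz) (hl.const_sub z)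
    exact (d1.sub d2).congr_deriv (by ring)
  rw [hasDerivAt_iff_tendsto_slope_zero] at hd
  have hlim := hd.mono_left (nhdsWithin_mono (0 : ℝ)
    (show Set.Ioi (0 : ℝ) ⊆ {0}ᶜ from fun t ht => ne_of_gt ht))
  refine ge_of_tendsto hlim ?_
  filter_upwards [Ioo_mem_nhdsGT zero_lt_one] with t ht
  have h1 := mul_log_Gamma_sub_le h0 hhz ht.1.le ht.2.le
  have hF0 : F 0 = 0 := by simp [hF]
  rw [hF0, zero_add, sub_zero, smul_eq_mul, ← div_eq_inv_mul, le_div_iff₀ ht.1]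
  linarith

/-- The multiplier `m` satisfies `log m ≥ -2 h ψ` by the previous bound, and `m ≥ 1 + log m`. -/
theorem one_sub_digamma_le_pittMultiplier {lam h : ℝ} (h0 : 0 < h) (h1 : h < lam + 1 / 2)
    (n : ℕ) : 1 - 2 * h * realDigamma (n + lam + 1 / 2) ≤ pittMultiplier lam h n := by
  have hn : (0 : ℝ) ≤ n := n.cast_nonneg
  have e1 := Real.Gamma_pos_of_pos (s := n + lam + 1 / 2 - h) (by linarith)
  have e2 := Real.Gamma_pos_of_pos (s := n + lam + 1 / 2 + h) (by linarith)
  have h2 := log_Gamma_sub_le_digamma (z := n + lam + 1 / 2) h0.le (by linarith)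
  have h3 := Real.one_sub_inv_le_log_of_pos (inv_pos.mpr (pittMultiplier_pos h0 h1 n))
  rw [inv_inv, Real.log_inv, pittMultiplier, Real.log_div e1.ne' e2.ne'] at h3
  rw [pittMultiplier]
  linarith

/-- By convexity of `log Γ`, whose chord over `[z, z + 1]` has slope `log z`. -/
theorem realDigamma_le_log {z : ℝ} (hz : 0 < z) : realDigamma z ≤ Real.log z := by
  have h := Real.convexOn_log_Gamma.le_slope_of_hasDerivAt (x := z) (y := z + 1) hz
    (show (0 : ℝ) < z + 1 by linarith) (by linarith) (hasDerivAt_log_Gamma hz)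
  have hG := (Real.Gamma_pos_of_pos hz).ne'
  simpa [slope_def_field, Real.Gamma_add_one hz.ne', Real.log_mul hz.ne' hG] using h

theorem log_sub_one_le_realDigamma {z : ℝ} (hz : 1 < z) : Real.log (z - 1) ≤ realDigamma z := by
  have hz' : 0 < z - 1 := by linarith
  have h := Real.convexOn_log_Gamma.slope_le_of_hasDerivAt (x := z - 1) (y := z) hz'
    (show (0 : ℝ) < z by linarith) (by linarith) (hasDerivAt_log_Gamma (by linarith))
  have hG := (Real.Gamma_pos_of_pos hz').ne'
  have e : Real.Gamma z = (z - 1) * Real.Gamma (z - 1) := by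
    rw [← Real.Gamma_add_one hz'.ne', sub_add_cancel]
  simpa [slope_def_field, e, Real.log_mul hz'.ne' hG] using h

theorem MemUltraSobolev.memUltraLog {lam σ : ℝ} (hlam : 0 < lam) (hσ : 0 < σ) {u : ℝ → ℝ}
    (hu : MemUltraSobolev lam σ u) : MemUltraLog lam u := by
  refine ⟨hu.1, (hu.2.mul_left (2 ^ σ / σ)).of_norm_bounded_eventually_nat ?_⟩
  -- From `n = 2` on the digamma factor is certainly nonnegative, so the absolute value in the
  -- comparison can be dropped.
  filter_upwards [Filter.eventually_ge_atTop 2] with n hn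
  have hn' : (2 : ℝ) ≤ n := by exact_mod_cast hn
  have h1 : 0 ≤ realDigamma (n + lam + 1 / 2) :=
    (Real.log_nonneg (by linarith)).trans (log_sub_one_le_realDigamma (by linarith))
  have h2 : realDigamma (n + lam + 1 / 2) ≤ 2 ^ σ / σ * (n + lam) ^ σ := by
    calc realDigamma (n + lam + 1 / 2) ≤ Real.log (n + lam + 1 / 2) :=
          realDigamma_le_log (by linarith)
      _ ≤ (n + lam + 1 / 2) ^ σ / σ := Real.log_le_rpow_div (by linarith) hσ
      _ ≤ (2 * (n + lam)) ^ σ / σ := by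
          gcongr
          linarith
      _ = 2 ^ σ / σ * (n + lam) ^ σ := by
          rw [Real.mul_rpow (by norm_num) (by linarith)]; ring
  rw [Real.norm_eq_abs, abs_of_nonneg (mul_nonneg h1 (sq_nonneg _)), ← mul_assoc]
  exact mul_le_mul_of_nonneg_right h2 (sq_nonneg _)

/-! ### Differentiation at `h = 0` and the logarithmic inequality. -/

theorem tendsto_one_sub_div {F : ℝ → ℝ} {d : ℝ} (hF : HasDerivAt F d 0) (hF0 : F 0 = 1)
    {h : ℕ → ℝ} (hpos : ∀ k, 0 < h k) (hlim : Filter.Tendsto h Filter.atTop (𝓝 0)) :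
    Filter.Tendsto (fun k => (1 - F (h k)) / (2 * h k)) Filter.atTop (𝓝 (-d / 2)) := by
  rw [hasDerivAt_iff_tendsto_slope_zero] at hF
  have h1 : Filter.Tendsto h Filter.atTop (𝓝[≠] 0) :=
    tendsto_nhdsWithin_iff.mpr ⟨hlim, Filter.Eventually.of_forall fun k => (hpos k).ne'⟩
  have h2 := ((hF.comp h1).neg).div_const 2
  refine h2.congr fun k => ?_
  have := (hpos k).ne'
  simp only [Function.comp_apply, zero_add, hF0, smul_eq_mul]
  field_simp
  ring

theorem hasDerivAt_pittConst {lam : ℝ} (hlam : 0 < lam) :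
    HasDerivAt (pittConst lam) (-2 * (Real.log 2 + realDigamma (lam / 2 + 1 / 4))) 0 := by
  set p := lam / 2 + 1 / 4 with hp
  have hp0 : 0 < p := by positivity
  have hG := (Real.Gamma_pos_of_pos hp0).ne'
  have hl : HasDerivAt (fun t : ℝ => t / 2) (1 / 2) 0 := (hasDerivAt_id (0 : ℝ)).div_const 2
  have hΓ : HasDerivAt Real.Gamma (realDigamma p * Real.Gamma p) p := by
    rw [realDigamma, div_mul_cancel₀ _ hG]
    exact (Real.differentiableAt_Gamma fun m => by
      have : (0 : ℝ) ≤ m := m.cast_nonneg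
      linarith).hasDerivAt
  have d1 := (HasDerivAt.comp (𝕜 := ℝ) 0 (h₂ := Real.Gamma)
    (by rw [zero_div, sub_zero]; exact hΓ) (hl.const_sub p)).pow 2
  have d2 := (HasDerivAt.comp (𝕜 := ℝ) 0 (h₂ := Real.Gamma)
    (by rw [zero_div, add_zero]; exact hΓ) (hl.const_add p)).pow 2
  have d3 : HasDerivAt (fun t : ℝ => (2 : ℝ) ^ (-2 * t)) (-2 * Real.log 2) 0 := by
    have h1 := HasDerivAt.comp (𝕜 := ℝ) 0 (h₂ := fun y => (2 : ℝ) ^ y)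
      (Real.hasStrictDerivAt_const_rpow two_pos _).hasDerivAt
      ((hasDerivAt_id (0 : ℝ)).const_mul (-2))
    exact h1.congr_deriv (by simp [mul_comm])
  have d4 := d3.mul (d1.div d2 (by simpa using hG))
  refine d4.congr_deriv ?_
  simp
  field_simp
  ring

theorem pittConst_zero {lam : ℝ} (hlam : 0 < lam) : pittConst lam 0 = 1 := by
  have hG := (Real.Gamma_pos_of_pos (s := lam / 2 + 1 / 4) (by positivity)).ne'
  simp only [pittConst, mul_zero, Real.rpow_zero, zero_div, sub_zero, add_zero, one_mul]
  exact div_self (pow_ne_zero 2 hG)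

theorem pitt_inequality_digamma {lam h : ℝ} (hlam : 0 < lam) (h0 : 0 < h) (h1 : h < lam + 1 / 2)
    {u : ℝ → ℝ} (hu : MemUltraLog lam u) :
    ∫ x, u x ^ 2 ∂(ultraMeasure lam)
        - 2 * h * ∑' n : ℕ, realDigamma (n + lam + 1 / 2) * ultraCoeff lam u n ^ 2
      ≤ pittConst lam h * ∫ x, (1 - x ^ 2) ^ h * u x ^ 2 ∂(ultraMeasure lam) := by
  have hs := (hasSum_ultraCoeff_sq hlam hu.1).sub (hu.2.hasSum.mul_left (2 * h))
  refine le_of_tendsto' hs.tendsto_sum_nat fun N =>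
    (Finset.sum_le_sum fun n _ => ?_).trans (pitt_inequality hlam h0 h1 hu.1 N)
  have := mul_le_mul_of_nonneg_right (one_sub_digamma_le_pittMultiplier h0 h1 n)
    (sq_nonneg (ultraCoeff lam u n))
  linarith

theorem log_sqrt_weight_nonpos (x : ℝ) :
    Real.log (Real.sqrt (1 - x ^ 2)) ≤ 0 :=
  Real.log_nonpos (Real.sqrt_nonneg _)
    (Real.sqrt_le_one.mpr (by nlinarith [sq_nonneg x]))

theorem log_inequality {lam : ℝ} (hlam : 0 < lam) {u : ℝ → ℝ} (hu : MemUltraLog lam u) :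
    Integrable (fun x : ℝ => Real.log (Real.sqrt (1 - x ^ 2)) * u x ^ 2) (ultraMeasure lam) ∧
      (Real.log 2 + realDigamma (lam / 2 + 1 / 4)) * ∫ x, u x ^ 2 ∂(ultraMeasure lam) ≤
        (∑' n : ℕ, realDigamma ((n : ℝ) + lam + 1 / 2) * (ultraCoeff lam u n) ^ 2) +
          ∫ x, Real.log (Real.sqrt (1 - x ^ 2)) * u x ^ 2 ∂(ultraMeasure lam) := by
  set S := ∑' n : ℕ, realDigamma ((n : ℝ) + lam + 1 / 2) * (ultraCoeff lam u n) ^ 2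
  set M := ∫ x, u x ^ 2 ∂(ultraMeasure lam) with hM
  set K := Real.log 2 + realDigamma (lam / 2 + 1 / 4) with hK
  set μ := ultraMeasure lam
  -- A null sequence inside `(0, lam + 1/2)`, where Pitt's inequality is available.
  set h : ℕ → ℝ := fun k => (lam + 1 / 2) / 2 * (1 / ((k : ℝ) + 1)) with hh
  have hpos : ∀ k, 0 < h k := fun k => by positivity
  have hlt : ∀ k, h k < lam + 1 / 2 := fun k => by
    have h1 : 1 / ((k : ℝ) + 1) ≤ 1 := by
      rw [div_le_one (by positivity)]; linarith [k.cast_nonneg (α := ℝ)]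
    have h2 : h k ≤ (lam + 1 / 2) / 2 := mul_le_of_le_one_right (by positivity) h1
    linarith
  have hlim : Filter.Tendsto h Filter.atTop (𝓝 0) := by
    have := (tendsto_one_div_add_atTop_nhds_zero_nat (𝕜 := ℝ)).const_mul ((lam + 1 / 2) / 2)
    rwa [mul_zero] at this
  -- These difference quotients are nonnegative on the interval and converge there to `-log √(1 - x
  -- ^ 2) u ^ 2`.
  set F : ℕ → ℝ → ℝ := fun k x => (1 - (1 - x ^ 2) ^ h k) / (2 * h k) * u x ^ 2 with hF
  have hF0 : ∀ k, ∀ x ∈ Set.Ioo (-1 : ℝ) 1, 0 ≤ F k x := fun k x hx =>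
    mul_nonneg (div_nonneg (sub_nonneg.mpr (rpow_weight_le_one (hpos k) hx))
      (by linarith [hpos k])) (sq_nonneg _)
  have hFeq : ∀ k x, F k x = (2 * h k)⁻¹ * (u x ^ 2 - (1 - x ^ 2) ^ h k * u x ^ 2) := fun k x => by
    simp only [hF]; ring
  have hFint : ∀ k, Integrable (F k) μ := fun k => by
    have := (hu.1.integrable_sq.sub (integrable_rpow_weight_mul_sq (hpos k) hu.1)).const_mul
      (2 * h k)⁻¹
    exact this.congr (Filter.Eventually.of_forall fun x => (hFeq k x).symm)
  have hFle : ∀ k, ∫ x, F k x ∂μ ≤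
      (S - M * ((1 - pittConst lam (h k)) / (2 * h k))) / pittConst lam (h k) := fun k => by
    have h1 := pitt_inequality_digamma hlam (hpos k) (hlt k) hu
    have hc := pittConst_pos (hpos k) (hlt k)
    have h2 := hpos k
    have h3 : ∫ x, F k x ∂μ
        = (2 * h k)⁻¹ * (M - ∫ x, (1 - x ^ 2) ^ h k * u x ^ 2 ∂μ) := by
      rw [hM, ← integral_sub hu.1.integrable_sq (integrable_rpow_weight_mul_sq (hpos k) hu.1),
        ← integral_const_mul]
      exact integral_congr_ae (Filter.Eventually.of_forall (hFeq k))
    rw [h3, le_div_iff₀ hc]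
    have h4 : S - M * ((1 - pittConst lam (h k)) / (2 * h k)) -
        (2 * h k)⁻¹ * (M - ∫ x, (1 - x ^ 2) ^ h k * u x ^ 2 ∂μ) * pittConst lam (h k)
        = (2 * h k)⁻¹ * (pittConst lam (h k) * (∫ x, (1 - x ^ 2) ^ h k * u x ^ 2 ∂μ)
          - (M - 2 * h k * S)) := by
      field_simp
      ring
    have h5 : 0 ≤ (2 * h k)⁻¹ * (pittConst lam (h k) * (∫ x, (1 - x ^ 2) ^ h k * u x ^ 2 ∂μ)
          - (M - 2 * h k * S)) := mul_nonneg (by positivity) (sub_nonneg.mpr h1)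
    linarith
  have hbound : Filter.Tendsto
      (fun k => (S - M * ((1 - pittConst lam (h k)) / (2 * h k))) / pittConst lam (h k))
      Filter.atTop (𝓝 (S - M * K)) := by
    have hd := hasDerivAt_pittConst hlam
    have h1 := tendsto_one_sub_div hd (pittConst_zero hlam) hpos hlim
    have h2 : Filter.Tendsto (fun k => pittConst lam (h k)) Filter.atTop (𝓝 1) := by
      have := hd.continuousAt.tendsto.comp hlim
      rwa [pittConst_zero hlam] at this
    have h3 := ((h1.const_mul M).const_sub S).div h2 one_ne_zero
    rw [div_one] at h3
    rwa [show -(-2 * (Real.log 2 + realDigamma (lam / 2 + 1 / 4))) / 2 = K by rw [hK]; ring] at h3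
  -- Nonnegativity ensures that `ENNReal.ofReal` does not truncate the bound when returning to real
  -- integrals.
  have hSMK : 0 ≤ S - M * K := ge_of_tendsto' hbound fun k =>
    (integral_nonneg_of_ae ((ae_ultraMeasure_mem lam).mono (hF0 k))).trans (hFle k)
  set G : ℝ → ℝ := fun x => -(Real.log (Real.sqrt (1 - x ^ 2)) * u x ^ 2) with hG
  have hG0 : 0 ≤ᵐ[μ] G :=
    Filter.Eventually.of_forall fun x => neg_nonneg.mpr
      (mul_nonpos_of_nonpos_of_nonneg (log_sqrt_weight_nonpos x) (sq_nonneg _))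
  have hGlim : ∀ x ∈ Set.Ioo (-1 : ℝ) 1,
      Filter.Tendsto (fun k => F k x) Filter.atTop (𝓝 (G x)) := by
    intro x hx
    have hd := (Real.hasStrictDerivAt_const_rpow (weight_pos hx) 0).hasDerivAt
    rw [Real.rpow_zero, one_mul] at hd
    have h1 := (tendsto_one_sub_div hd (Real.rpow_zero _) hpos hlim).mul_const (u x ^ 2)
    convert h1 using 2
    simp only [hG]
    rw [Real.log_sqrt (weight_pos hx).le]
    ring
  have hGm : AEStronglyMeasurable G μ :=
    ((by fun_prop : Measurable fun x : ℝ =>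
      Real.log (Real.sqrt (1 - x ^ 2))).aestronglyMeasurable.mul
        (hu.1.aestronglyMeasurable.pow 2)).neg
  -- Fatou requires no prior integrability of the limit, so this single bound gives both claims.
  have hfatou : ∫⁻ x, ENNReal.ofReal (G x) ∂μ ≤ ENNReal.ofReal (S - M * K) := by
    calc ∫⁻ x, ENNReal.ofReal (G x) ∂μ
        = ∫⁻ x, Filter.liminf (fun k => ENNReal.ofReal (F k x)) Filter.atTop ∂μ := by
          refine lintegral_congr_ae ?_
          filter_upwards [ae_ultraMeasure_mem lam] with x hx
          exact ((ENNReal.continuous_ofReal.tendsto _).comp (hGlim x hx)).liminf_eq.symm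
      _ ≤ Filter.liminf (fun k => ∫⁻ x, ENNReal.ofReal (F k x) ∂μ) Filter.atTop :=
          lintegral_liminf_le' fun k => (hFint k).aestronglyMeasurable.aemeasurable.ennreal_ofReal
      _ ≤ Filter.liminf (fun k => ENNReal.ofReal
            ((S - M * ((1 - pittConst lam (h k)) / (2 * h k))) / pittConst lam (h k)))
            Filter.atTop := by
          refine Filter.liminf_le_liminf (Filter.Eventually.of_forall fun k => ?_)
          rw [← ofReal_integral_eq_lintegral_ofReal (hFint k)
            ((ae_ultraMeasure_mem lam).mono (hF0 k))]
          exact ENNReal.ofReal_le_ofReal (hFle k)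
      _ = ENNReal.ofReal (S - M * K) :=
          ((ENNReal.continuous_ofReal.tendsto _).comp hbound).liminf_eq
  have hGint : Integrable G μ :=
    ⟨hGm, (hasFiniteIntegral_iff_ofReal hG0).mpr (hfatou.trans_lt ENNReal.ofReal_lt_top)⟩
  have hGle : ∫ x, G x ∂μ ≤ S - M * K := by
    rw [integral_eq_lintegral_of_nonneg_ae hG0 hGm]
    exact (ENNReal.toReal_mono ENNReal.ofReal_ne_top hfatou).trans_eq (ENNReal.toReal_ofReal hSMK)
  have hneg : ∫ x, G x ∂μ = -∫ x, Real.log (Real.sqrt (1 - x ^ 2)) * u x ^ 2 ∂μ := integral_neg _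
  refine ⟨by simpa [hG] using hGint.neg, ?_⟩
  rw [hneg] at hGle
  linarith

theorem mainTheorem4 (lam : ℝ) (hlam : 0 < lam) (u : ℝ → ℝ) :
    (∀ σ : ℝ, 0 < σ → MemUltraSobolev lam σ u → MemUltraLog lam u) ∧
    (MemUltraLog lam u →
      Integrable (fun x : ℝ => Real.log (Real.sqrt (1 - x ^ 2)) * u x ^ 2) (ultraMeasure lam) ∧
      (Real.log 2 + realDigamma (lam / 2 + 1 / 4)) * ∫ x, u x ^ 2 ∂(ultraMeasure lam) ≤
        (∑' n : ℕ, realDigamma ((n : ℝ) + lam + 1 / 2) * (ultraCoeff lam u n) ^ 2) +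
          ∫ x, Real.log (Real.sqrt (1 - x ^ 2)) * u x ^ 2 ∂(ultraMeasure lam)) :=
  ⟨fun _ hσ hu => hu.memUltraLog hlam hσ, log_inequality hlam⟩
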